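/- Let $\mathbb{k}$ be an algebraically closed field. A $\mathbb{k}$-linear abelian category is called finite if all its morphism spaces are finite-dimensional, every object has finite length, every simple object has a projective cover, and there are only finitely many isomorphism classes of simple objects. Let $\mathcal{X}$ be a finite $\mathbb{k}$-linear category, and let $\mathcal{L}ex(\mathcal{X},\mathcal{X})$ and $\mathcal{R}ex(\mathcal{X},\mathcal{X})$ denote the $\mathbb{k}$-linear left exact and right exact endofunctors of $\mathcal{X}$. Write $\langle x,y\rangle$ for the space of morphisms $x\to y$ in $\mathcal{X}$, $(-)^{\star}$ for the linear dual, and $\otimes$ for the action of finite-dimensional vector spaces on $\mathcal{X}$, so that $V\otimes x$ is a direct sum of $\dim V$ copies of $x$. Let $\boxtimes:\mathcal{X}^{\mathrm{opp}}\times\mathcal{X}\to\mathcal{X}^{\mathrm{opp}}\boxtimes\mathcal{X}$ be a Deligne product: a finite $\mathbb{k}$-linear category with a bilinear bifunctor that is right exact in both variables, such that for every finite $\mathbb{k}$-linear category $\mathcal{E}$ composition with $\boxtimes$ is an equivalence from the right exact linear functors $\mathcal{X}^{\mathrm{opp}}\boxtimes\mathcal{X}\to\mathcal{E}$ to the bilinear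 bifunctors $\mathcal{X}^{\mathrm{opp}}\times\mathcal{X}\to\mathcal{E}$ that are right exact in both variables. Let $$\Phi^{\mathrm{l}}:\mathcal{X}^{\mathrm{opp}}\boxtimes\mathcal{X}\to\mathcal{L}ex(\mathcal{X},\mathcal{X}),\quad \bar a\boxtimes b\mapsto b\otimes\langle a,-\rangle,\qquad \Phi^{\mathrm{r}}:\mathcal{X}^{\mathrm{opp}}\boxtimes\mathcal{X}\to\mathcal{R}ex(\mathcal{X},\mathcal{X}),\quad \bar a\boxtimes b\mapsto b\otimes\langle -,a\rangle^{\star}$$ be the Eilenberg–Watts functors, that is, the linear functors which extend (up to natural isomorphism) the displayed assignments and which are, for $\Phi^{\mathrm{l}}$, left exact and, for $\Phi^{\mathrm{r}}$, right exact as functors to the category of endofunctors of $\mathcal{X}$. For a linear endofunctor $F$ of $\mathcal{X}$, not necessarily exact, put $$\Gamma^{\mathrm{rl}}(F):=\Phi^{\mathrm{r}}\Big(\int^{x\in\mathcal{X}}\bar x\boxtimes F(x)\Big),\qquad \Gamma^{\mathrm{lr}}(F):=\Phi^{\mathrm{l}}\Big(\int_{x\in\mathcal{X}}\bar x\boxtimes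 F(x)\Big)$$ whenever the coend, respectively the end, exists. (i) For all $F,G\in\mathcal{L}ex(\mathcal{X},\mathcal{X})$ the coends defining $\Gamma^{\mathrm{rl}}(F)$, $\Gamma^{\mathrm{rl}}(G)$ and $\Gamma^{\mathrm{rl}}(\Gamma^{\mathrm{rl}}(F)\circ G)$ exist, and there is a natural isomorphism of functors $$\Gamma^{\mathrm{rl}}(F)\circ\Gamma^{\mathrm{rl}}(G)\;\cong\;\Gamma^{\mathrm{rl}}\big(\Gamma^{\mathrm{rl}}(F)\circ G\big).$$ (ii) For all $F,G\in\mathcal{R}ex(\mathcal{X},\mathcal{X})$ the ends defining $\Gamma^{\mathrm{lr}}(F)$, $\Gamma^{\mathrm{lr}}(G)$ and $\Gamma^{\mathrm{lr}}(\Gamma^{\mathrm{lr}}(F)\circ G)$ exist, and there is a natural isomorphism of functors $$\Gamma^{\mathrm{lr}}(F)\circ\Gamma^{\mathrm{lr}}(G)\;\cong\;\Gamma^{\mathrm{lr}}\big(\Gamma^{\mathrm{lr}}(F)\circ G\big).$$ -/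

import Mathlib

open CategoryTheory Limits Opposite

universe v u w u₁ u₂ u₃ u₄

namespace EilenbergWatts

/-- The opposite of a `k`-linear category is `k`-linear. -/
instance linearOpposite (k : Type v) [Semiring k] (C : Type u) [Category.{v} C] [Preadditive C]
    [Linear k C] : Linear k Cᵒᵖ where
  homModule X Y :=
    { smul := fun r f => (r • f.unop).op
      one_smul := fun f => congrArg Quiver.Hom.op (one_smul k f.unop)
      mul_smul := fun r s f => congrArg Quiver.Hom.op (mul_smul r s f.unop)
      smul_zero := fun r => congrArg Quiver.Hom.op (smul_zero (A := unop Y ⟶ unop X) r)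
      smul_add := fun r f g => congrArg Quiver.Hom.op (smul_add r f.unop g.unop)
      add_smul := fun r s f => congrArg Quiver.Hom.op (add_smul r s f.unop)
      zero_smul := fun f => congrArg Quiver.Hom.op (zero_smul k f.unop) }
  smul_comp _ _ _ r f g := congrArg Quiver.Hom.op (Linear.comp_smul _ _ _ g.unop r f.unop)
  comp_smul _ _ _ f r g := congrArg Quiver.Hom.op (Linear.smul_comp _ _ _ r g.unop f.unop)

/-- `S` has a projective cover: an epimorphism `p` from a projective object which is essential,
i.e. a morphism `g` into the source of `p` is epi as soon as `g ≫ p` is. -/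
def HasProjectiveCover {C : Type u} [Category.{v} C] (S : C) : Prop :=
  ∃ (Q : C) (p : Q ⟶ S), Projective Q ∧ Epi p ∧
    ∀ ⦃Z : C⦄ (g : Z ⟶ Q), Epi (g ≫ p) → Epi g

/-- Finite `k`-linear categories. (An object of an abelian category has finite length if and only
if it is Noetherian and Artinian.) -/
class FiniteLinearCategory (k : Type v) [Field k] (C : Type u) [Category.{v} C] [Abelian C]
    [Linear k C] : Prop where
  finite_hom : ∀ x y : C, Module.Finite k (x ⟶ y)
  finite_length : ∀ x : C, IsNoetherianObject x ∧ IsArtinianObject x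
  projective_cover : ∀ S : C, Simple S → HasProjectiveCover S
  finitely_many_simples :
    ∃ (n : ℕ) (s : Fin n → C), ∀ S : C, Simple S → ∃ i, Nonempty (S ≅ s i)

attribute [instance] FiniteLinearCategory.finite_hom

section Exactness

variable (k : Type v) [Field k]
  {C : Type u₁} [Category.{v} C] [Preadditive C] [Linear k C]
  {D : Type u₂} [Category.{v} D] [Preadditive D] [Linear k D]

/-- `k`-linear functors. -/
structure IsLinearFunctor {E : Type u₃} [Category.{u₄} E] [Preadditive E] [Linear k E]
    (F : C ⥤ E) : Prop where
  additive : F.Additive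
  linear : F.Linear k

/-- Left exact `k`-linear functors. -/
structure IsLex {E : Type u₃} [Category.{u₄} E] [Preadditive E] [Linear k E]
    (F : C ⥤ E) : Prop extends IsLinearFunctor k F where
  preservesFiniteLimits : PreservesFiniteLimits F

/-- Right exact `k`-linear functors. -/
structure IsRex {E : Type u₃} [Category.{u₄} E] [Preadditive E] [Linear k E]
    (F : C ⥤ E) : Prop extends IsLinearFunctor k F where
  preservesFiniteColimits : PreservesFiniteColimits F

/-- Bilinear bifunctors that are right exact in both variables. -/
structure IsBiRex {E : Type u₃} [Category.{v} E] [Preadditive E] [Linear k E]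
    (B : C ⥤ D ⥤ E) : Prop where
  right : ∀ c : C, IsRex k (B.obj c)
  left : ∀ d : D, IsRex k (B.flip.obj d)

end Exactness

section Deligne

variable {C : Type u₁} [Category.{v} C] {D : Type u₂} [Category.{v} D]
  {P : Type u₃} [Category.{v} P]

/-- The bifunctor `(c, d) ↦ G (T (c, d))`. -/
abbrev restrict (T : C ⥤ D ⥤ P) {E : Type u} [Category.{u₄} E] (G : P ⥤ E) : C ⥤ D ⥤ E :=
  T ⋙ (Functor.whiskeringRight D P E).obj G

/-- The restriction to the bifunctor `T` of a natural transformation. -/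
abbrev restrictMap (T : C ⥤ D ⥤ P) {E : Type u} [Category.{u₄} E] {G G' : P ⥤ E} (α : G ⟶ G') :
    restrict T G ⟶ restrict T G' :=
  Functor.whiskerLeft T ((Functor.whiskeringRight D P E).map α)

variable (k : Type v) [Field k] [Abelian C] [Linear k C] [Abelian D] [Linear k D]
  [Abelian P] [Linear k P]

/-- `T` exhibits the finite linear category `P` as a Deligne product of `C` and `D`: it is right
exact in both variables, and for every finite linear category `E`, restriction along `T` is an
equivalence (essentially surjective and fully faithful) from the right exact functors `P ⥤ E` to
the bifunctors `C ⥤ D ⥤ E` that are right exact in both variables. Every finite linear category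
whose morphism spaces lie in `Type v` is equivalent to one whose objects form a `Type (v + 1)`, so
that the universe of `E` is no restriction. -/
structure IsDeligneProduct [FiniteLinearCategory k P] (T : C ⥤ D ⥤ P) : Prop where
  biRex : IsBiRex k T
  exists_extension : ∀ {E : Type (v + 1)} [Category.{v} E] [Abelian E] [Linear k E]
    [FiniteLinearCategory k E] (B : C ⥤ D ⥤ E), IsBiRex k B →
      ∃ G : P ⥤ E, IsRex k G ∧ Nonempty (restrict T G ≅ B)
  extension_unique : ∀ {E : Type (v + 1)} [Category.{v} E] [Abelian E] [Linear k E]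
    [FiniteLinearCategory k E] (G G' : P ⥤ E), IsRex k G → IsRex k G' →
      Function.Bijective (fun α : G ⟶ G' => restrictMap T α)

end Deligne

noncomputable section

section Copower

attribute [local instance] Abelian.hasFiniteBiproducts

variable (k : Type v) [Field k] (C : Type u) [Category.{v} C] [Abelian C] [Linear k C]

/-- The action `(V, c) ↦ V ⊗ c` of finite-dimensional vector spaces on `C`: after the choice of a
basis of each `V`, the object `V ⊗ c` is the direct sum of `dim V` copies of `c`, and `f ⊗ g` is
given by the matrix of `f` with entries multiplied by `g`. -/
def copower : FGModuleCat.{v} k ⥤ C ⥤ C where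
  obj V :=
    { obj := fun c => ⨁ (fun _ : Fin (Module.finrank k V) => c)
      map := fun g => biproduct.map (fun _ => g)
      map_id := fun c => by ext; simp
      map_comp := fun f g => by ext; simp }
  map {V W} f :=
    { app := fun c => biproduct.matrix (fun i j =>
        (LinearMap.toMatrix (Module.finBasis k V) (Module.finBasis k W) f.hom.hom j i) • 𝟙 c)
      naturality := fun c c' g => by ext; simp }
  map_id V := by
    refine NatTrans.ext (funext fun c => ?_)
    dsimp only
    rw [FGModuleCat.hom_hom_id, LinearMap.toMatrix_id]
    refine biproduct.hom_ext' _ _ fun i => biproduct.hom_ext _ _ fun j => ?_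
    by_cases h : i = j
    · subst h
      simp
    · simp [biproduct.ι_π_ne (fun _ : Fin (Module.finrank k V) => c) h, Matrix.one_apply_ne' h]
  map_comp {U V W} f g := by
    refine NatTrans.ext (funext fun c => ?_)
    dsimp only [NatTrans.comp_app]
    rw [FGModuleCat.hom_hom_comp, LinearMap.toMatrix_comp _ (Module.finBasis k V)]
    refine biproduct.hom_ext' _ _ fun i => biproduct.hom_ext _ _ fun j => ?_
    simp [biproduct.lift_matrix, Matrix.mul_apply, Finset.sum_smul, smul_smul, mul_comm]

end Copower

section Hom

variable (k : Type v) [Field k] (C : Type u) [Category.{v} C] [Abelian C] [Linear k C]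
  [FiniteLinearCategory k C]

/-- The functor `(a, y) ↦ Hom(a, y)` with values in finite-dimensional vector spaces. -/
def homFunctor : Cᵒᵖ ⥤ C ⥤ FGModuleCat.{v} k where
  obj a :=
    { obj := fun y => FGModuleCat.of k (a.unop ⟶ y)
      map := fun g => FGModuleCat.ofHom (Linear.rightComp k a.unop g)
      map_id := fun _ => by ext f; exact Category.comp_id f
      map_comp := fun _ _ => by ext f; exact (Category.assoc f _ _).symm }
  map f :=
    { app := fun y => FGModuleCat.ofHom (Linear.leftComp k y f.unop)
      naturality := fun _ _ _ => by ext h; exact (Category.assoc f.unop h _).symm }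
  map_id a := by ext y f; exact Category.id_comp f
  map_comp f g := by ext y h; exact Category.assoc g.unop f.unop h

/-- The functor `(a, y) ↦ Hom(y, a)⋆` with values in finite-dimensional vector spaces. -/
def homDualFunctor : Cᵒᵖ ⥤ C ⥤ FGModuleCat.{v} k where
  obj a :=
    { obj := fun y => FGModuleCat.of k (Module.Dual k (y ⟶ a.unop))
      map := fun g => FGModuleCat.ofHom (Linear.leftComp k a.unop g).dualMap
      map_id := fun y => by
        ext φ h
        exact congrArg (DFunLike.coe (F := Module.Dual k (y ⟶ a.unop)) φ) (Category.id_comp h)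
      map_comp := fun {y _ _} f g => by
        ext φ h
        exact congrArg (DFunLike.coe (F := Module.Dual k (y ⟶ a.unop)) φ) (Category.assoc f g h) }
  map f :=
    { app := fun y => FGModuleCat.ofHom (Linear.rightComp k y f.unop).dualMap
      naturality := fun y y' g => by
        ext φ h
        exact congrArg (DFunLike.coe (F := Module.Dual k (y ⟶ _)) φ)
          (Category.assoc g h f.unop).symm }
  map_id a := by
    ext y φ h
    exact congrArg (DFunLike.coe (F := Module.Dual k (y ⟶ a.unop)) φ) (Category.comp_id h)
  map_comp f g := by
    ext y φ h
    exact congrArg (DFunLike.coe (F := Module.Dual k (y ⟶ _)) φ)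
      (Category.assoc h g.unop f.unop).symm

end Hom

section EilenbergWattsFunctors

variable (k : Type v) [Field k]
  {A : Type u₁} [Category.{v} A] [Abelian A] [Linear k A] [FiniteLinearCategory k A]
  {B : Type u₂} [Category.{v} B] [Abelian B] [Linear k B]
  {P : Type u₃} [Category.{v} P] [Abelian P] [Linear k P]

variable (A B) in
/-- The assignment `(a, b) ↦ b ⊗ Hom(a, -)`. -/
def phiLKernel : Aᵒᵖ ⥤ B ⥤ A ⥤ B :=
  homFunctor k A ⋙ (Functor.whiskeringRight A (FGModuleCat.{v} k) (B ⥤ B)).obj (copower k B) ⋙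
    flipFunctor A B B

variable (A B) in
/-- The assignment `(a, b) ↦ b ⊗ Hom(-, a)⋆`. -/
def phiRKernel : Aᵒᵖ ⥤ B ⥤ A ⥤ B :=
  homDualFunctor k A ⋙ (Functor.whiskeringRight A (FGModuleCat.{v} k) (B ⥤ B)).obj (copower k B) ⋙
    flipFunctor A B B

/-- `Φ` is the functor `Φˡ : Aᵒᵖ ⊠ B ⥤ Lex(A, B)`, `a ⊠ b ↦ b ⊗ Hom(a, -)`. The assignment on the
objects `a ⊠ b` is left exact in both variables and `Φˡ` is its left exact extension; limits of left
exact functors are computed pointwise, so that exactness can be stated in `A ⥤ B`. -/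
structure IsPhiL (T : Aᵒᵖ ⥤ B ⥤ P) (Φ : P ⥤ A ⥤ B) : Prop where
  isLex : IsLex k Φ
  isLex_obj : ∀ d : P, IsLex k (Φ.obj d)
  on_boxes : Nonempty (restrict T Φ ≅ phiLKernel k A B)

/-- `Φ` is the functor `Φʳ : Aᵒᵖ ⊠ B ⥤ Rex(A, B)`, `a ⊠ b ↦ b ⊗ Hom(-, a)⋆`. The assignment on the
objects `a ⊠ b` is right exact in both variables and `Φʳ` is its right exact extension; colimits of
right exact functors are computed pointwise, so that exactness can be stated in `A ⥤ B`. -/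
structure IsPhiR (T : Aᵒᵖ ⥤ B ⥤ P) (Φ : P ⥤ A ⥤ B) : Prop where
  isRex : IsRex k Φ
  isRex_obj : ∀ d : P, IsRex k (Φ.obj d)
  on_boxes : Nonempty (restrict T Φ ≅ phiRKernel k A B)

/-- The bifunctor `(a', a) ↦ a' ⊠ F(a)`. -/
abbrev boxFunctor (T : Aᵒᵖ ⥤ B ⥤ P) (F : A ⥤ B) : Aᵒᵖ ⥤ A ⥤ P :=
  T ⋙ (Functor.whiskeringLeft A B P).obj F

/-- `Ψˡ(F) = ∫^a a ⊠ F(a)`, for every functor `F` for which this coend exists. -/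
def psiL (T : Aᵒᵖ ⥤ B ⥤ P) (F : A ⥤ B) [HasCoend (boxFunctor T F)] : P :=
  coend (boxFunctor T F)

/-- `Ψʳ(G) = ∫_a a ⊠ G(a)`, for every functor `G` for which this end exists. -/
def psiR (T : Aᵒᵖ ⥤ B ⥤ P) (G : A ⥤ B) [HasEnd (boxFunctor T G)] : P :=
  end_ (boxFunctor T G)

/-- `Γʳˡ(F) = Φʳ(Ψˡ(F))`. -/
def gammaRL (T : Aᵒᵖ ⥤ B ⥤ P) (Φr : P ⥤ A ⥤ B) (F : A ⥤ B) [HasCoend (boxFunctor T F)] : A ⥤ B :=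
  Φr.obj (psiL T F)

/-- `Γˡʳ(G) = Φˡ(Ψʳ(G))`. -/
def gammaLR (T : Aᵒᵖ ⥤ B ⥤ P) (Φl : P ⥤ A ⥤ B) (G : A ⥤ B) [HasEnd (boxFunctor T G)] : A ⥤ B :=
  Φl.obj (psiR T G)

end EilenbergWattsFunctors

end

end EilenbergWatts

open EilenbergWatts

/-! The functor `R` = Γʳˡ(F) is linear and right exact, whatever linear `F` it comes from. The coend
∫^x x̄ ⊠ G(x) is a finite colimit: if `I` is an injective cogenerator of `X`, that is, a projective
generator of `Xᵒᵖ`, it is the quotient of Ī ⊠ G(I) by the relations that identify the two actions of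
a basis of End(I) (`exists_hasCoend_isJointCokernel`). Both Φʳ and postcomposition with `R` preserve
such a presentation. A linear functor commutes with the action of vector spaces, so R ∘ Φʳ(Ī ⊠ b) ≅
Φʳ(Ī ⊠ R(b)), naturally in both variables (`boxCompIso`). Hence R ∘ Γʳˡ(G) and Γʳˡ(R ∘ G) have
isomorphic presentations (`boxCompIso_relation`) and are isomorphic.

For ends the same argument runs with kernels and a projective generator `Q`, but it needs ⊠ to be
left exact in the contravariant variable, whereas the universal property speaks of right exactness
only. This is `IsDeligneProduct.isLex_flip_obj`: applied to functors with values in vector spaces,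
the universal property shows that ⊠ preserves monomorphisms (`IsDeligneProduct.mono_map_app`).

The generator `Q` is the sum of the projective covers of the simple objects, and `I` represents the
functor Hom(Q, -)⋆. -/

namespace EilenbergWatts

/-! ### Finite-dimensional vector spaces as a finite linear category. -/

section VectorSpaces

variable {k : Type v} [Field k]

lemma epi_of_surjective {V W : FGModuleCat.{v} k} (f : V ⟶ W)
    (hf : Function.Surjective f.hom.hom) : Epi f :=
  (forget₂ (FGModuleCat.{v} k) (ModuleCat.{v} k)).epi_of_epi_map
    ((ModuleCat.epi_iff_surjective _).2 hf)

lemma mono_of_injective {V W : FGModuleCat.{v} k} (f : V ⟶ W)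
    (hf : Function.Injective f.hom.hom) : Mono f :=
  (forget₂ (FGModuleCat.{v} k) (ModuleCat.{v} k)).mono_of_mono_map
    ((ModuleCat.mono_iff_injective _).2 hf)

lemma injective_of_mono {V W : FGModuleCat.{v} k} (f : V ⟶ W) [Mono f] :
    Function.Injective f.hom.hom :=
  (ModuleCat.mono_iff_injective ((forget₂ (FGModuleCat.{v} k) (ModuleCat.{v} k)).map f)).1
    inferInstance

lemma surjective_of_epi {V W : FGModuleCat.{v} k} (f : V ⟶ W) [Epi f] :
    Function.Surjective f.hom.hom :=
  (ModuleCat.epi_iff_surjective ((forget₂ (FGModuleCat.{v} k) (ModuleCat.{v} k)).map f)).1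
    inferInstance

lemma finrank_lt_of_mono {V W : FGModuleCat.{v} k} (f : V ⟶ W) [Mono f] (hf : ¬ IsIso f) :
    Module.finrank k V < Module.finrank k W := by
  refine lt_of_le_of_ne (LinearMap.finrank_le_finrank_of_injective (injective_of_mono f))
    fun h => hf ?_
  have := epi_of_surjective f
    ((LinearMap.injective_iff_surjective_of_finrank_eq_finrank h).1 (injective_of_mono f))
  exact isIso_of_mono_of_epi f

lemma finrank_subobject_strictMono (V : FGModuleCat.{v} k) :
    StrictMono fun Y : Subobject V => Module.finrank k (Y : FGModuleCat.{v} k) := by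
  intro Y Z h
  refine finrank_lt_of_mono (Subobject.ofLE Y Z h.le) fun hi => h.not_ge ?_
  exact Subobject.le_of_comm (inv (Subobject.ofLE Y Z h.le)) (by simp)

/-- This makes vector spaces an admissible target in the universal property of the Deligne product,
which is tested below on functors with these values only. -/
instance finiteLinearCategory_fgModuleCat : FiniteLinearCategory k (FGModuleCat.{v} k) where
  finite_hom _ _ := inferInstance
  finite_length V := by
    have hm := finrank_subobject_strictMono V
    have hle (Y : Subobject V) : Module.finrank k (Y : FGModuleCat.{v} k) ≤ Module.finrank k V :=
      LinearMap.finrank_le_finrank_of_injective (injective_of_mono Y.arrow)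
    -- Ascending chains are bounded by codimension, descending ones by dimension.
    refine ⟨⟨StrictAnti.wellFoundedGT
      (f := fun Y => Module.finrank k V - Module.finrank k (Y : FGModuleCat.{v} k)) ?_⟩,
      ⟨hm.wellFoundedLT⟩⟩
    intro Y Z h
    have h₁ := hm h
    have h₂ := hle Z
    dsimp only at h₁ ⊢
    omega
  projective_cover S _ := by
    refine ⟨S, 𝟙 S, ⟨fun {E Y} f e he => ?_⟩, inferInstance, fun Z g hg => by simpa using hg⟩
    obtain ⟨s, hs⟩ := LinearMap.exists_rightInverse_of_surjective e.hom.hom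
      (LinearMap.range_eq_top.2 (surjective_of_epi e))
    refine ⟨FGModuleCat.ofHom (s ∘ₗ f.hom.hom), ?_⟩
    ext x
    exact LinearMap.congr_fun hs (f.hom.hom x)
  finitely_many_simples := by
    refine ⟨1, fun _ => FGModuleCat.of k k, fun S hS => ⟨0, ?_⟩⟩
    have hnt : ∃ s : S, s ≠ 0 := by
      by_contra! h
      apply id_nonzero S
      ext x
      exact h x
    obtain ⟨s, hs⟩ := hnt
    let f : FGModuleCat.of k k ⟶ S := FGModuleCat.ofHom (LinearMap.toSpanSingleton k S s)
    have : Mono f := mono_of_injective f <|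
      LinearMap.ker_eq_bot.1 (LinearMap.ker_toSpanSingleton k hs)
    have hf : f ≠ 0 := fun h => hs (by
      have := congrArg (fun g => g.hom.hom (1 : k)) h
      exact (one_smul k s).symm.trans this)
    have := isIso_of_mono_of_nonzero hf
    exact ⟨(asIso f).symm⟩

lemma preservesFiniteColimits_of_exact {C : Type u} [Category.{v} C] [Abelian C]
    (F : C ⥤ FGModuleCat.{v} k) [F.Additive]
    (h : ∀ S : ShortComplex C, S.ShortExact →
      Function.Exact (F.map S.f).hom.hom (F.map S.g).hom.hom ∧
        Function.Surjective (F.map S.g).hom.hom) :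
    PreservesFiniteColimits F := by
  refine ((Functor.preservesFiniteColimits_tfae F).out 0 3 rfl rfl).1 fun S hS => ⟨?_, ?_⟩
  · rw [← ShortComplex.exact_map_iff_of_faithful _
      (forget₂ (FGModuleCat.{v} k) (ModuleCat.{v} k)),
      ShortComplex.ShortExact.moduleCat_exact_iff_function_exact]
    exact (h S hS).1
  · exact epi_of_surjective _ (h S hS).2

lemma exact_dualMap {U V W : Type v} [AddCommGroup U] [Module k U] [AddCommGroup V] [Module k V]
    [AddCommGroup W] [Module k W] {f : U →ₗ[k] V} {g : V →ₗ[k] W} (h : Function.Exact f g) :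
    Function.Exact g.dualMap f.dualMap := by
  rw [LinearMap.exact_iff] at h ⊢
  rw [LinearMap.ker_dualMap_eq_dualAnnihilator_range, LinearMap.range_dualMap_eq_dualAnnihilator_ker,
    h]

end VectorSpaces

/-! ### Right exact functors with values in vector spaces. -/

section HomFunctors

variable (k : Type v) [Field k]

/-- Hom(-, z) turns cokernels into kernels and duality of vector spaces is exact. These functors
detect objects and morphisms of a Deligne product. -/
lemma isRex_homDualFunctor {C : Type u} [Category.{v} C] [Abelian C] [Linear k C]
    [FiniteLinearCategory k C] (z : Cᵒᵖ) : IsRex k ((homDualFunctor k C).obj z) := by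
  have hadd : ((homDualFunctor k C).obj z).Additive := ⟨fun {X Y f g} => by
    ext φ : 2
    refine LinearMap.ext fun h => ?_
    exact (congrArg (DFunLike.coe (F := Module.Dual k (X ⟶ z.unop)) φ)
      (Preadditive.add_comp _ _ _ f g h)).trans (map_add _ _ _)⟩
  refine ⟨⟨hadd, ⟨fun {X Y} f r => ?_⟩⟩, preservesFiniteColimits_of_exact _ fun S hS => ?_⟩
  · ext φ : 2
    refine LinearMap.ext fun h => ?_
    exact (congrArg (DFunLike.coe (F := Module.Dual k (X ⟶ z.unop)) φ)
      (Linear.smul_comp _ _ _ r f h)).trans (map_smul _ _ _)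
  · have := hS.epi_g
    refine ⟨exact_dualMap (f := Linear.leftComp k z.unop S.g) (g := Linear.leftComp k z.unop S.f)
        fun h => ⟨fun hh => ⟨hS.exact.desc h hh, hS.exact.g_desc h hh⟩, ?_⟩,
      LinearMap.dualMap_surjective_of_injective
        (f := Linear.leftComp k z.unop S.g) fun h h' hh => (cancel_epi S.g).1 hh⟩
    rintro ⟨h, rfl⟩
    exact (S.zero_assoc h).trans zero_comp

lemma exact_rightComp_of_projective {C : Type u} [Category.{v} C] [Abelian C] [Linear k C] (M : C)
    [Projective M] {S : ShortComplex C} (hS : S.ShortExact) :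
    Function.Exact (Linear.rightComp k M S.f) (Linear.rightComp k M S.g) ∧
      Function.Surjective (Linear.rightComp k M S.g) := by
  have := hS.epi_g
  refine ⟨fun h => ⟨fun hh => ⟨hS.exact.liftFromProjective h hh,
    hS.exact.liftFromProjective_comp h hh⟩, ?_⟩,
    fun h => ⟨Projective.factorThru h S.g, Projective.factorThru_comp h S.g⟩⟩
  rintro ⟨h, rfl⟩
  exact (Category.assoc h _ _).trans ((congrArg (h ≫ ·) S.zero).trans comp_zero)

variable {C : Type u₁} [Category.{v} C] [Abelian C] [Linear k C]
  {D : Type u₂} [Category.{v} D] [Abelian D] [Linear k D]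
  [∀ x y : C, Module.Finite k (x ⟶ y)] [∀ x y : D, Module.Finite k (x ⟶ y)]

open TensorProduct in
/-- The bifunctor `(c, d) ↦ Hom(M, c) ⊗ Hom(N, d)`. -/
noncomputable def homTensorHom (M : C) (N : D) : C ⥤ D ⥤ FGModuleCat.{v} k where
  obj c :=
    { obj := fun d => FGModuleCat.of k ((M ⟶ c) ⊗[k] (N ⟶ d))
      map := fun g => FGModuleCat.ofHom (LinearMap.lTensor (M ⟶ c) (Linear.rightComp k N g))
      map_id := fun d => by
        ext : 1
        refine TensorProduct.ext' fun s t => ?_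
        exact congrArg (s ⊗ₜ[k] ·) (Category.comp_id t)
      map_comp := fun f g => by
        ext : 1
        refine TensorProduct.ext' fun s t => ?_
        exact congrArg (s ⊗ₜ[k] ·) (Category.assoc t f g).symm }
  map f :=
    { app := fun d => FGModuleCat.ofHom (LinearMap.rTensor (N ⟶ d) (Linear.rightComp k M f))
      naturality := fun d d' g => by
        ext : 1
        exact TensorProduct.ext' fun s t => rfl }
  map_id c := by
    ext d : 3
    refine TensorProduct.ext' fun s t => ?_
    exact congrArg (· ⊗ₜ[k] t) (Category.comp_id s)
  map_comp f g := by
    ext d : 3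
    refine TensorProduct.ext' fun s t => ?_
    exact congrArg (· ⊗ₜ[k] t) (Category.assoc s f g).symm

lemma isBiRex_homTensorHom (M : C) (N : D) [Projective M] [Projective N] :
    IsBiRex k (homTensorHom k M N) where
  right c := by
    have hadd : ((homTensorHom k M N).obj c).Additive := ⟨fun {X Y f g} => by
      ext : 1
      refine TensorProduct.ext' fun s t => ?_
      exact (congrArg (TensorProduct.tmul k s) (Preadditive.comp_add _ _ _ t f g)).trans
        (TensorProduct.tmul_add _ _ _)⟩
    refine ⟨⟨hadd, ⟨fun {X Y} f r => ?_⟩⟩, preservesFiniteColimits_of_exact _ fun S hS => ?_⟩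
    · ext : 1
      refine TensorProduct.ext' fun s t => ?_
      exact (congrArg (TensorProduct.tmul k s) (Linear.comp_smul _ _ _ t r f)).trans
        (TensorProduct.tmul_smul _ _ _)
    · obtain ⟨h₁, h₂⟩ := exact_rightComp_of_projective k N hS
      exact ⟨lTensor_exact _ h₁ h₂, LinearMap.lTensor_surjective _ h₂⟩
  left d := by
    have hadd : ((homTensorHom k M N).flip.obj d).Additive := ⟨fun {X Y f g} => by
      ext : 1
      refine TensorProduct.ext' fun s t => ?_
      exact (congrArg (fun z => TensorProduct.tmul k z t) (Preadditive.comp_add _ _ _ s f g)).trans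
        (TensorProduct.add_tmul _ _ _)⟩
    refine ⟨⟨hadd, ⟨fun {X Y} f r => ?_⟩⟩, preservesFiniteColimits_of_exact _ fun S hS => ?_⟩
    · ext : 1
      refine TensorProduct.ext' fun s t => ?_
      exact (congrArg (fun z => TensorProduct.tmul k z t) (Linear.comp_smul _ _ _ s r f)).trans
        (TensorProduct.smul_tmul' _ _ _)
    · obtain ⟨h₁, h₂⟩ := exact_rightComp_of_projective k M hS
      exact ⟨rTensor_exact _ h₁ h₂, LinearMap.rTensor_surjective _ h₂⟩

/-- Tensoring over a field is exact. This is where left exactness of ⊠ ultimately comes from. -/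
lemma homTensorHom_map_injective (M : C) (N : D) {c c' : C} (f : c ⟶ c') [Mono f] (d : D) :
    Function.Injective (((homTensorHom k M N).map f).app d).hom.hom :=
  Module.Flat.rTensor_preserves_injective_linearMap (M := (N ⟶ d)) (Linear.rightComp k M f)
    fun _ _ h => (cancel_mono f).1 h

end HomFunctors

/-! ### Projective separators and injective coseparators. -/

section Generators

open scoped ZeroObject

attribute [local instance] Abelian.hasFiniteBiproducts

variable (k : Type v) [Field k] {C : Type u} [Category.{v} C] [Abelian C] [Linear k C]

lemma projective_biproduct {C : Type u} [Category.{v} C] [Abelian C] {n : ℕ} (Q : Fin n → C)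
    (hQ : ∀ i, Projective (Q i)) : Projective (⨁ Q) :=
  ⟨fun f e _ => ⟨biproduct.desc fun i => Projective.factorThru (biproduct.ι Q i ≫ f) e, by
    ext i; simp⟩⟩

variable (C) in
lemma exists_projective_isSeparator [FiniteLinearCategory k C] :
    ∃ Q : C, Projective Q ∧ IsSeparator Q := by
  obtain ⟨n, s, hs⟩ := FiniteLinearCategory.finitely_many_simples k (C := C)
  have hQ (i : Fin n) : ∃ Q : C, Projective Q ∧ (Simple (s i) → ∃ p : Q ⟶ s i, Epi p) := by
    by_cases h : Simple (s i)
    · obtain ⟨Q, p, hQ, hp, -⟩ := FiniteLinearCategory.projective_cover (k := k) (s i) h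
      exact ⟨Q, hQ, fun _ => ⟨p, hp⟩⟩
    -- The list `s` may contain objects that are not simple; they contribute a zero summand.
    · exact ⟨0, inferInstance, fun h' => absurd h' h⟩
  choose Q hQ hp using hQ
  have hproj := projective_biproduct Q hQ
  refine ⟨⨁ Q, hproj, (Preadditive.isSeparator_iff _).2 fun x y f hf => ?_⟩
  by_contra hne
  have hz : ¬ IsZero (Abelian.image f) := fun h => hne <| by
    rw [← Abelian.image.fac f, h.eq_of_tgt (Abelian.factorThruImage f) 0, zero_comp]
  have := (FiniteLinearCategory.finite_length (k := k) (Abelian.image f)).2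
  -- The image of a nonzero `f` contains a simple object, onto which the sum of the covers maps;
  -- this map lifts along the epimorphism from `x` onto the image, so `f` cannot kill all morphisms
  -- out of `⨁ Q`.
  let S := simpleSubobject hz
  let j : S ⟶ Abelian.image f := simpleSubobjectArrow hz
  obtain ⟨i, ⟨e⟩⟩ := hs S inferInstance
  have : Simple (s i) := Simple.of_iso e.symm
  obtain ⟨p, hp⟩ := hp i this
  let q : ⨁ Q ⟶ S := biproduct.π Q i ≫ p ≫ e.inv
  have h₁ : (q ≫ j) ≫ Abelian.image.ι f = 0 := by
    rw [← Projective.factorThru_comp (q ≫ j) (Abelian.factorThruImage f), Category.assoc,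
      Abelian.image.fac]
    exact hf _
  have h₂ : q = 0 := by
    rw [← cancel_mono j, ← cancel_mono (Abelian.image.ι f), h₁]
    simp
  have h₃ : Epi q := by dsimp only [q]; infer_instance
  exact id_nonzero S ((cancel_epi q).1 (by rw [h₂]; simp))

/-- A linear form on `Hom(Q, x)` whose kernel contains no nonzero `End(Q)`-submodule. -/
def IsEssentialForm {Q x : C} (ξ : Module.Dual k (Q ⟶ x)) : Prop :=
  ∀ φ : Q ⟶ x, (∀ a : Q ⟶ Q, ξ (a ≫ φ) = 0) → φ = 0

variable {k} [∀ x y : C, Module.Finite k (x ⟶ y)] {Q : C}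

/-- An essential form embeds Hom(Q, x) into End(Q)⋆ by φ ↦ ξ(- ≫ φ). The bound does not depend on
`x`. -/
lemma IsEssentialForm.finrank_le {x : C} {ξ : Module.Dual k (Q ⟶ x)} (h : IsEssentialForm k ξ) :
    Module.finrank k (Q ⟶ x) ≤ Module.finrank k (Module.Dual k (Q ⟶ Q)) := by
  let f : (Q ⟶ x) →ₗ[k] Module.Dual k (Q ⟶ Q) :=
    { toFun := fun φ => ξ ∘ₗ Linear.rightComp k Q φ
      map_add' := fun φ ψ => by ext a; simp
      map_smul' := fun r φ => by ext a; simp }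
  refine LinearMap.finrank_le_finrank_of_injective (f := f) ?_
  rw [← LinearMap.ker_eq_bot, LinearMap.ker_eq_bot']
  exact fun φ hφ => h φ fun a => LinearMap.congr_fun hφ a

/-- Divide `z` by the subobject generated by `R`, the largest End(Q)-submodule of ker ξ. As `Q` is
projective, Hom(Q, z) maps onto Hom(Q, y) and whatever it kills is a combination of elements of `R`,
so ξ descends. -/
lemma exists_isEssentialForm_quotient [Projective Q] {z : C} (ξ : Module.Dual k (Q ⟶ z)) :
    ∃ (y : C) (p : z ⟶ y) (η : Module.Dual k (Q ⟶ y)), IsEssentialForm k η ∧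
      ∀ φ, η (φ ≫ p) = ξ φ := by
  let R : Submodule k (Q ⟶ z) := ⨅ a : Q ⟶ Q, LinearMap.ker (ξ ∘ₗ Linear.leftComp k z a)
  have hR (φ : Q ⟶ z) : φ ∈ R ↔ ∀ a : Q ⟶ Q, ξ (a ≫ φ) = 0 := by simp [R]
  let b := Module.finBasis k R
  let g : (⨁ fun _ : Fin (Module.finrank k R) => Q) ⟶ z :=
    biproduct.desc fun i => (b i : Q ⟶ z)
  let p := cokernel.π g
  have h₁ (φ : Q ⟶ z) (hφ : φ ≫ p = 0) : ξ φ = 0 := by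
    have hex := ShortComplex.exact_cokernel g
    rw [← hex.liftFromProjective_comp φ hφ]
    set l := hex.liftFromProjective φ hφ
    change ξ (l ≫ g) = 0
    rw [show g = _ from biproduct.desc_eq, Preadditive.comp_sum, map_sum]
    refine Finset.sum_eq_zero fun i _ => ?_
    rw [← Category.assoc]
    exact (hR _).1 (b i).2 _
  have h₂ (φ : Q ⟶ z) (hφ : φ ∈ R) : φ ≫ p = 0 := by
    have hb (i) : (b i : Q ⟶ z) ≫ p = 0 := by
      have : (b i : Q ⟶ z) = biproduct.ι _ i ≫ g := by simp [g]
      rw [this, Category.assoc, cokernel.condition, comp_zero]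
    exact LinearMap.congr_fun (b.ext hb : Linear.rightComp k Q p ∘ₗ R.subtype = 0) ⟨φ, hφ⟩
  have hs : Function.Surjective (Linear.rightComp k Q p) := fun φ =>
    ⟨Projective.factorThru φ p, Projective.factorThru_comp φ p⟩
  have hξ : ξ ∈ LinearMap.range (Linear.rightComp k Q p).dualMap := by
    rw [LinearMap.range_dualMap_eq_dualAnnihilator_ker, Submodule.mem_dualAnnihilator]
    exact fun φ hφ => h₁ φ hφ
  obtain ⟨η, hη⟩ := hξ
  have hη' (φ : Q ⟶ z) : η (φ ≫ p) = ξ φ := LinearMap.congr_fun hη φ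
  refine ⟨_, p, η, fun φ hφ => ?_, hη'⟩
  obtain ⟨ψ, rfl⟩ := hs φ
  refine h₂ ψ ((hR ψ).2 fun a => ?_)
  rw [← hη', Category.assoc]
  exact hφ a

/-- The two properties say that f ↦ ξ(- ≫ f) is a bijection from Hom(x, I) to Hom(Q, x)⋆. An
essential form for which Hom(Q, I) has maximal dimension is universal. -/
lemma exists_form_representing_dual [Projective Q] (hQ : IsSeparator Q) :
    ∃ (I : C) (ξ : Module.Dual k (Q ⟶ I)),
      (∀ ⦃x : C⦄ (f : x ⟶ I), (∀ q : Q ⟶ x, ξ (q ≫ f) = 0) → f = 0) ∧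
      ∀ ⦃x : C⦄ (η : Module.Dual k (Q ⟶ x)), ∃ f : x ⟶ I, ∀ q, ξ (q ≫ f) = η q := by
  let s : Set ℕ := {d | ∃ (x : C) (ξ : Module.Dual k (Q ⟶ x)), IsEssentialForm k ξ ∧
    Module.finrank k (Q ⟶ x) = d}
  have hne : s.Nonempty := by
    obtain ⟨y, -, η, hη, -⟩ := exists_isEssentialForm_quotient (0 : Module.Dual k (Q ⟶ Q))
    exact ⟨_, y, η, hη, rfl⟩
  have hbdd : BddAbove s := ⟨Module.finrank k (Module.Dual k (Q ⟶ Q)), by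
    rintro _ ⟨x, ξ, h, rfl⟩
    exact h.finrank_le⟩
  obtain ⟨I, ξ, hξ, hI⟩ := Nat.sSup_mem hne hbdd
  have hmax ⦃y : C⦄ (η : Module.Dual k (Q ⟶ y)) (hη : IsEssentialForm k η) :
      Module.finrank k (Q ⟶ y) ≤ Module.finrank k (Q ⟶ I) :=
    hI ▸ le_csSup hbdd ⟨y, η, hη, rfl⟩
  refine ⟨I, ξ, fun x f hf => ?_, fun x η => ?_⟩
  · refine (Preadditive.isSeparator_iff _).1 hQ f fun q => hξ _ fun a => ?_
    rw [← Category.assoc]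
    exact hf _
  -- Make the form ξ + η on `I ⊞ x` essential. Then `I` embeds into the quotient `y`, by maximality
  -- this embedding is invertible, and x ⟶ y ≅ I is the required morphism.
  · obtain ⟨y, p, ζ, hζ, hp⟩ := exists_isEssentialForm_quotient
      (ξ ∘ₗ Linear.rightComp k Q (biprod.fst : I ⊞ x ⟶ I) +
        η ∘ₗ Linear.rightComp k Q (biprod.snd : I ⊞ x ⟶ x))
    let i : I ⟶ y := biprod.inl ≫ p
    have hi (φ : Q ⟶ I) : ζ (φ ≫ i) = ξ φ := by
      rw [← Category.assoc, hp]
      simp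
    have hinj : Function.Injective (Linear.rightComp k Q i) := by
      rw [← LinearMap.ker_eq_bot, LinearMap.ker_eq_bot']
      refine fun φ hφ => hξ φ fun a => ?_
      have hφ' : φ ≫ i = 0 := hφ
      rw [← hi, Category.assoc, hφ', comp_zero, map_zero]
    have hsurj : Function.Surjective (Linear.rightComp k Q i) :=
      (LinearMap.injective_iff_surjective_of_finrank_eq_finrank
        (le_antisymm (LinearMap.finrank_le_finrank_of_injective hinj) (hmax ζ hζ))).1 hinj
    have : Mono i := Preadditive.mono_of_cancel_zero _ fun g hg => by
      refine (Preadditive.isSeparator_iff _).1 hQ g fun q => hinj ?_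
      simp [hg]
    have : Epi i := Preadditive.epi_of_cancel_zero _ fun g hg => by
      refine (Preadditive.isSeparator_iff _).1 hQ g fun q => ?_
      obtain ⟨φ, rfl⟩ := hsurj q
      simp [hg]
    have := isIso_of_mono_of_epi i
    refine ⟨biprod.inr ≫ p ≫ inv i, fun q => ?_⟩
    rw [← hi]
    simp only [Category.assoc, IsIso.inv_hom_id, Category.comp_id]
    rw [← Category.assoc, hp]
    simp

/-- Hom(-, I) is isomorphic to Hom(Q, -)⋆, which is exact because `Q` is projective and faithful
because `Q` is a separator. -/
lemma exists_injective_isCoseparator (k : Type v) [Field k] {C : Type u} [Category.{v} C]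
    [Abelian C] [Linear k C] [∀ x y : C, Module.Finite k (x ⟶ y)] {Q : C} [Projective Q] (hQ : IsSeparator Q) :
    ∃ I : C, Injective I ∧ IsCoseparator I := by
  obtain ⟨I, ξ, h₁, h₂⟩ := exists_form_representing_dual (k := k) hQ
  refine ⟨I, ⟨fun {x y} g m hm => ?_⟩, (Preadditive.isCoseparator_iff _).2 fun x y f hf => ?_⟩
  · obtain ⟨η, hη⟩ := LinearMap.dualMap_surjective_of_injective (f := Linear.rightComp k Q m)
      (fun _ _ h => (cancel_mono m).1 h) (ξ ∘ₗ Linear.rightComp k Q g)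
    obtain ⟨f, hf⟩ := h₂ η
    refine ⟨f, sub_eq_zero.1 (h₁ _ fun q => ?_)⟩
    have := LinearMap.congr_fun hη q
    simp only [LinearMap.dualMap_apply, LinearMap.comp_apply, Linear.rightComp_apply] at this
    rw [Preadditive.comp_sub, map_sub, ← Category.assoc, hf, this, sub_self]
  · refine (Preadditive.isSeparator_iff _).1 hQ f fun q => ?_
    refine (Module.forall_dual_apply_eq_zero_iff k _).1 fun η => ?_
    obtain ⟨g, hg⟩ := h₂ η
    rw [← hg, Category.assoc, hf, comp_zero, map_zero]

end Generators

/-! ### Right exact functors are determined on a projective generator. -/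

section Separators

attribute [local instance] Abelian.hasFiniteBiproducts

/-- Every object is a quotient of a finite direct sum of copies of `M`. -/
def IsFiniteGenerator {C : Type u₁} [Category.{v} C] [Abelian C] (M : C) : Prop :=
  ∀ x : C, ∃ (n : ℕ) (p : (⨁ fun _ : Fin n => M) ⟶ x), Epi p

lemma isFiniteGenerator_of_isSeparator (k : Type v) [Field k] {C : Type u₁} [Category.{v} C]
    [Abelian C] [Linear k C] [∀ x y : C, Module.Finite k (x ⟶ y)] {M : C} (hM : IsSeparator M) :
    IsFiniteGenerator M := by
  intro x
  let b := Module.finBasis k (M ⟶ x)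
  refine ⟨_, biproduct.desc b, Preadditive.epi_of_cancel_zero _ fun g hg => ?_⟩
  refine (Preadditive.isSeparator_iff _).1 hM g fun q => ?_
  have hb (i) : b i ≫ g = 0 := by
    rw [← biproduct.ι_desc b i, Category.assoc, hg, comp_zero]
  exact LinearMap.congr_fun (b.ext hb : Linear.rightComp k M g = 0) q

variable {C : Type u₁} [Category.{v} C] [Abelian C] {D : Type u₂} [Category.{v} D] [Preadditive D]

/-- A right exact functor sends the family of all morphisms out of a finite generator to a jointly
epimorphic family. -/
lemma eq_zero_of_map_comp_eq_zero (H : C ⥤ D) [H.Additive] [PreservesFiniteColimits H] {M : C}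
    (hM : IsFiniteGenerator M) {x : C} {e : D} (g : H.obj x ⟶ e)
    (hg : ∀ a : M ⟶ x, H.map a ≫ g = 0) : g = 0 := by
  obtain ⟨n, p, hp⟩ := hM x
  rw [← cancel_epi (H.map p), comp_zero]
  have := congrArg (fun f => H.map f ≫ H.map p ≫ g)
    (biproduct.total (f := fun _ : Fin n => M))
  rw [H.map_id, Category.id_comp] at this
  rw [← this, H.map_sum, Preadditive.sum_comp]
  refine Finset.sum_eq_zero fun i _ => ?_
  rw [H.map_comp, Category.assoc, ← H.map_comp_assoc (biproduct.ι _ i), hg, comp_zero]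

/-- A right exact functor `H` is the left Kan extension of its restriction to a projective
finite generator. -/
lemma existsUnique_desc_of_isFiniteGenerator (H : C ⥤ D) [H.Additive] [PreservesFiniteColimits H]
    {M : C} [Projective M] (hM : IsFiniteGenerator M) {x : C} {e : D}
    (φ : (M ⟶ x) →+ (H.obj M ⟶ e)) (hφ : ∀ (a : M ⟶ M) (b : M ⟶ x), φ (a ≫ b) = H.map a ≫ φ b) :
    ∃! ω : H.obj x ⟶ e, ∀ a : M ⟶ x, H.map a ≫ ω = φ a := by
  obtain ⟨n, p, hp⟩ := hM x
  -- The value on a sum of copies of `M` is forced by φ; it then descends along `H.map p`, a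
  -- cokernel of `H.map (kernel.ι p)`.
  let ψ : H.obj (⨁ fun _ : Fin n => M) ⟶ e :=
    ∑ i, H.map (biproduct.π _ i) ≫ φ (biproduct.ι (fun _ : Fin n => M) i ≫ p)
  have hψ (a : M ⟶ ⨁ fun _ : Fin n => M) : H.map a ≫ ψ = φ (a ≫ p) := by
    rw [Preadditive.comp_sum]
    conv_rhs => rw [← Category.comp_id a, ← biproduct.total, Preadditive.comp_sum,
      Preadditive.sum_comp, map_sum]
    refine Finset.sum_congr rfl fun i _ => ?_
    rw [← H.map_comp_assoc, ← hφ]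
    simp only [Category.assoc]
  have hz : H.map (kernel.ι p) ≫ ψ = 0 := by
    refine eq_zero_of_map_comp_eq_zero H hM _ fun a => ?_
    rw [← H.map_comp_assoc, hψ, Category.assoc, kernel.condition, comp_zero, map_zero]
  let S := ShortComplex.mk (kernel.ι p) p (kernel.condition p)
  have hS : S.Exact := ShortComplex.exact_kernel p
  have : Epi S.g := hp
  let hc := CokernelCofork.mapIsColimit _ hS.gIsCokernel H
  obtain ⟨ω, hω⟩ : ∃ ω : H.obj x ⟶ e, H.map p ≫ ω = ψ := by
    obtain ⟨ω, hω⟩ := CokernelCofork.IsColimit.desc' hc ψ hz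
    exact ⟨ω, hω⟩
  refine ⟨ω, fun a => ?_, fun ω' (h' : ∀ a : M ⟶ x, H.map a ≫ ω' = φ a) => ?_⟩
  · rw [← Projective.factorThru_comp a p, H.map_comp_assoc, hω, hψ]
  · rw [← sub_eq_zero]
    refine eq_zero_of_map_comp_eq_zero H hM _ fun a => ?_
    rw [Preadditive.comp_sub, h', sub_eq_zero, ← Projective.factorThru_comp a p, H.map_comp_assoc,
      hω, hψ]

end Separators

/-! ### The Deligne product preserves monomorphisms in the first variable. -/

section Deligne

open TensorProduct

variable {k : Type v} [Field k] {C : Type u₁} [Category.{v} C] [Abelian C] [Linear k C]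
  {D : Type u₂} [Category.{v} D] [Abelian D] [Linear k D]
  {P : Type u₃} [Category.{v} P] [Abelian P] [Linear k P] [FiniteLinearCategory k P]
  {T : C ⥤ D ⥤ P}

/-- An object `z` vanishes if all morphisms `T(M, N) ⟶ z` do. -/
lemma IsDeligneProduct.isZero_of_hom_eq_zero (hT : IsDeligneProduct k T) {M : C} {N : D}
    (hM : IsFiniteGenerator M) (hN : IsFiniteGenerator N) {z : P}
    (hz : ∀ φ : (T.obj M).obj N ⟶ z, φ = 0) : IsZero z := by
  have h (c : C) (d : D) (φ : (T.obj c).obj d ⟶ z) : φ = 0 := by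
    obtain ⟨⟨_, _⟩, _⟩ := hT.biRex.right c
    refine eq_zero_of_map_comp_eq_zero (T.obj c) hN φ fun a => ?_
    obtain ⟨⟨_, _⟩, _⟩ := hT.biRex.left N
    exact eq_zero_of_map_comp_eq_zero (T.flip.obj N) hM _ fun b => hz _
  let G := (homDualFunctor k P).obj (op z)
  have hG : IsRex k G := isRex_homDualFunctor k (op z)
  -- By right exactness every morphism T(c, d) ⟶ z vanishes, so the identity of Hom(-, z)⋆ restricts
  -- to zero along `T` and is therefore zero.
  have h0 : 𝟙 G = 0 := (hT.extension_unique G G hG hG).1 <| by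
    ext c d : 4
    ext ξ : 2
    refine LinearMap.ext fun φ => ?_
    exact (congrArg (DFunLike.coe (F := Module.Dual k _) ξ) (h c d φ)).trans (map_zero _)
  refine (IsZero.iff_id_eq_zero z).2 ((Module.forall_dual_apply_eq_zero_iff k _).1 fun ξ => ?_)
  exact LinearMap.congr_fun (congrArg (fun α => (α.app z).hom.hom ξ) h0 : ξ = 0) (𝟙 z)

variable [∀ x y : C, Module.Finite k (x ⟶ y)] [∀ x y : D, Module.Finite k (x ⟶ y)]

/-- The morphisms `(s, t) ↦ λ(T(s, t) ≫ -)` attached to a linear form `λ` on `Hom(T(M, N), z)`. -/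
noncomputable def homTensorHomToDual (hT : IsBiRex k T) (M : C) (N : D) {z : P}
    (l : Module.Dual k ((T.obj M).obj N ⟶ z)) :
    homTensorHom k M N ⟶ restrict T ((homDualFunctor k P).obj (op z)) where
  app c :=
    { app := fun d => FGModuleCat.ofHom <| TensorProduct.lift <| LinearMap.mk₂ k
        (fun s t => l ∘ₗ Linear.leftComp k z ((T.map s).app N ≫ (T.obj c).map t))
        (fun s s' t => by
          have := (hT.left N).additive
          ext ψ
          have h : (T.map (s + s')).app N = (T.map s).app N + (T.map s').app N :=
            (T.flip.obj N).map_add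
          simp [h])
        (fun r s t => by
          have := (hT.left N).linear
          ext ψ
          have h : (T.map (r • s)).app N = r • (T.map s).app N :=
            Functor.map_smul (F := T.flip.obj N) r s
          simp [h])
        (fun s t t' => by
          have := (hT.right c).additive
          ext ψ
          simp [Functor.map_add])
        (fun r s t => by
          have := (hT.right c).linear
          ext ψ
          simp [Functor.map_smul])
      naturality := fun d d' g => by
        ext : 1
        refine TensorProduct.ext' fun s t => LinearMap.ext fun ψ => ?_
        refine congrArg (DFunLike.coe (F := Module.Dual k _) l) ?_
        change ((T.map s).app N ≫ (T.obj c).map (t ≫ g)) ≫ ψ =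
          ((T.map s).app N ≫ (T.obj c).map t) ≫ (T.obj c).map g ≫ ψ
        simp }
  naturality c c' f := by
    ext d : 3
    refine TensorProduct.ext' fun s t => LinearMap.ext fun ψ => ?_
    refine congrArg (DFunLike.coe (F := Module.Dual k _) l) ?_
    change ((T.map (s ≫ f)).app N ≫ (T.obj c').map t) ≫ ψ =
      ((T.map s).app N ≫ (T.obj c).map t) ≫ (T.map f).app d ≫ ψ
    simp

/-- Let `G` extend Hom(M, -) ⊗ Hom(N, -) to `P`. It sends T(f, d) to an injective map, and its
element `u` over 1 ⊗ 1 detects morphisms out of T(M, N). Hence no nonzero morphism from T(M, N)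
reaches the kernel of T(f, d), and such a kernel vanishes. -/
lemma IsDeligneProduct.mono_map_app (hT : IsDeligneProduct k T) {M : C} {N : D}
    [Projective M] [Projective N] (hM : IsFiniteGenerator M) (hN : IsFiniteGenerator N)
    {c c' : C} (f : c ⟶ c') [Mono f] (d : D) : Mono ((T.map f).app d) := by
  obtain ⟨G, hG, ⟨e⟩⟩ := hT.exists_extension (homTensorHom k M N) (isBiRex_homTensorHom k M N)
  let u : G.obj ((T.obj M).obj N) := ((e.inv.app M).app N).hom.hom (𝟙 M ⊗ₜ[k] 𝟙 N)
  have hu : ((e.hom.app M).app N).hom.hom u = 𝟙 M ⊗ₜ[k] 𝟙 N :=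
    congrArg (fun α => ((α.app M).app N).hom.hom (𝟙 M ⊗ₜ[k] 𝟙 N)) e.inv_hom_id
  -- A linear form `l` on Hom(T(M, N), z) extends to a transformation G ⟶ Hom(-, z)⋆ that sends `u`
  -- to `l`. Naturality along φ then gives l(φ) = 0 for every `l`.
  have key {z : P} (φ : (T.obj M).obj N ⟶ z) (hφ : (G.map φ).hom.hom u = 0) : φ = 0 := by
    refine (Module.forall_dual_apply_eq_zero_iff k _).1 fun l => ?_
    obtain ⟨α, hα⟩ := (hT.extension_unique G _ hG (isRex_homDualFunctor k (op z))).2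
      (e.hom ≫ homTensorHomToDual hT.biRex M N l)
    have h₁ : (α.app ((T.obj M).obj N)).hom.hom u = l := by
      have h := congrArg (fun α => ((α.app M).app N).hom.hom u) hα
      refine h.trans ?_
      change (((homTensorHomToDual hT.biRex M N l).app M).app N).hom.hom
        (((e.hom.app M).app N).hom.hom u) = l
      rw [hu]
      refine LinearMap.ext fun ψ => congrArg (DFunLike.coe (F := Module.Dual k _) l) ?_
      change ((T.map (𝟙 M)).app N ≫ (T.obj M).map (𝟙 N)) ≫ ψ = ψ
      simp
    have h₂ := congrArg (fun f => f.hom.hom u) (α.naturality φ)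
    change (α.app z).hom.hom ((G.map φ).hom.hom u) = (Linear.leftComp k z φ).dualMap
      ((α.app ((T.obj M).obj N)).hom.hom u) at h₂
    rw [hφ, map_zero, h₁] at h₂
    have h₃ := LinearMap.congr_fun h₂ (𝟙 z)
    rw [← Category.comp_id φ]
    exact h₃.symm
  refine Preadditive.mono_of_isZero_kernel _ (hT.isZero_of_hom_eq_zero hM hN fun φ => ?_)
  rw [← cancel_mono (kernel.ι _), zero_comp]
  refine key _ ?_
  set x := (G.map (φ ≫ kernel.ι ((T.map f).app d))).hom.hom u with hx
  have h₁ : (G.map ((T.map f).app d)).hom.hom x = 0 := by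
    have := congrArg (fun g => g.hom.hom u)
      (G.map_comp (φ ≫ kernel.ι ((T.map f).app d)) ((T.map f).app d))
    refine this.symm.trans ?_
    obtain ⟨⟨_, _⟩, _⟩ := hG
    rw [Category.assoc, kernel.condition, comp_zero, G.map_zero]
    rfl
  have h₂ := congrArg (fun α => (α.app d).hom.hom x) (e.hom.naturality f)
  change ((e.hom.app c').app d).hom.hom ((G.map ((T.map f).app d)).hom.hom x) =
    (((homTensorHom k M N).map f).app d).hom.hom (((e.hom.app c).app d).hom.hom x) at h₂
  rw [h₁, map_zero] at h₂
  have h₃ : ((e.hom.app c).app d).hom.hom x = 0 :=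
    homTensorHom_map_injective k M N f d (h₂.symm.trans (map_zero _).symm)
  have h₄ := congrArg (fun α => ((α.app c).app d).hom.hom x) e.hom_inv_id
  change ((e.inv.app c).app d).hom.hom (((e.hom.app c).app d).hom.hom x) = x at h₄
  rw [← h₄, h₃, map_zero]

end Deligne

/-! ### Finite presentations and their transport along exact functors. -/

section JointCokernels

variable {D : Type u₁} [Category.{w} D] [Preadditive D]

/-- `π` is universal among the morphisms annihilated by all `r j`. -/
structure IsJointCokernel {J : Type} {A B E : D} (r : J → (A ⟶ B)) (π : B ⟶ E) : Prop where
  zero : ∀ j, r j ≫ π = 0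
  existsUnique : ∀ {Z : D} (g : B ⟶ Z), (∀ j, r j ≫ g = 0) → ∃! h : E ⟶ Z, π ≫ h = g

/-- `ι` is universal among the morphisms annihilated by all `r j`. -/
structure IsJointKernel {J : Type} {A B E : D} (r : J → (A ⟶ B)) (ι : E ⟶ A) : Prop where
  zero : ∀ j, ι ≫ r j = 0
  existsUnique : ∀ {Z : D} (g : Z ⟶ A), (∀ j, g ≫ r j = 0) → ∃! h : Z ⟶ E, h ≫ ι = g

lemma IsJointCokernel.nonempty_iso {J : Type} {A B E A' B' E' : D} {r : J → (A ⟶ B)} {π : B ⟶ E}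
    {r' : J → (A' ⟶ B')} {π' : B' ⟶ E'} (h : IsJointCokernel r π) (h' : IsJointCokernel r' π')
    (a : A ≅ A') (b : B ≅ B') (hab : ∀ j, r j ≫ b.hom = a.hom ≫ r' j) : Nonempty (E ≅ E') := by
  have hab' (j) : r' j ≫ b.inv = a.inv ≫ r j := by
    rw [← cancel_epi a.hom, ← Category.assoc, ← hab]
    simp
  obtain ⟨f, hf, -⟩ := h.existsUnique (b.hom ≫ π') fun j => by
    rw [← Category.assoc, hab, Category.assoc, h'.zero, comp_zero]
  obtain ⟨g, hg, -⟩ := h'.existsUnique (b.inv ≫ π) fun j => by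
    rw [← Category.assoc, hab', Category.assoc, h.zero, comp_zero]
  refine ⟨⟨f, g, (h.existsUnique π h.zero).unique ?_ (Category.comp_id _),
    (h'.existsUnique π' h'.zero).unique ?_ (Category.comp_id _)⟩⟩
  · rw [← Category.assoc, hf, Category.assoc, hg, Iso.hom_inv_id_assoc]
  · rw [← Category.assoc, hg, Category.assoc, hf, Iso.inv_hom_id_assoc]

lemma IsJointKernel.nonempty_iso {J : Type} {A B E A' B' E' : D} {r : J → (A ⟶ B)} {ι : E ⟶ A}
    {r' : J → (A' ⟶ B')} {ι' : E' ⟶ A'} (h : IsJointKernel r ι) (h' : IsJointKernel r' ι')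
    (a : A ≅ A') (b : B ≅ B') (hab : ∀ j, r j ≫ b.hom = a.hom ≫ r' j) : Nonempty (E ≅ E') := by
  have hab' (j) : a.inv ≫ r j = r' j ≫ b.inv := by
    rw [← cancel_epi a.hom, ← Category.assoc a.hom (r' j), ← hab]
    simp
  obtain ⟨f, hf, -⟩ := h'.existsUnique (ι ≫ a.hom) fun j => by
    rw [Category.assoc, ← hab, ← Category.assoc, h.zero, zero_comp]
  obtain ⟨g, hg, -⟩ := h.existsUnique (ι' ≫ a.inv) fun j => by
    rw [Category.assoc, hab', ← Category.assoc, h'.zero, zero_comp]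
  refine ⟨⟨f, g, (h.existsUnique ι h.zero).unique ?_ (Category.id_comp _),
    (h'.existsUnique ι' h'.zero).unique ?_ (Category.id_comp _)⟩⟩
  · rw [Category.assoc, hg, ← Category.assoc, hf, Category.assoc, Iso.hom_inv_id, Category.comp_id]
  · rw [Category.assoc, hf, ← Category.assoc, hg, Category.assoc, Iso.inv_hom_id, Category.comp_id]

lemma IsJointCokernel.comp_iso {J : Type} {A B E E' : D} {r : J → (A ⟶ B)} {π : B ⟶ E}
    (h : IsJointCokernel r π) (e : E ≅ E') : IsJointCokernel r (π ≫ e.hom) := by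
  refine ⟨fun j => by rw [← Category.assoc, h.zero, zero_comp], fun g hg => ?_⟩
  obtain ⟨f, hf, hu⟩ := h.existsUnique g hg
  refine ⟨e.inv ≫ f, by simpa using hf, fun f' hf' => ?_⟩
  rw [← hu (e.hom ≫ f') (by simpa using hf'), Iso.inv_hom_id_assoc]

lemma IsJointKernel.iso_comp {J : Type} {A B E E' : D} {r : J → (A ⟶ B)} {ι : E ⟶ A}
    (h : IsJointKernel r ι) (e : E' ≅ E) : IsJointKernel r (e.hom ≫ ι) := by
  refine ⟨fun j => by rw [Category.assoc, h.zero, comp_zero], fun g hg => ?_⟩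
  obtain ⟨f, hf, hu⟩ := h.existsUnique g hg
  refine ⟨f ≫ e.inv, by simpa using hf, fun f' hf' => ?_⟩
  rw [← hu (f' ≫ e.hom) (by simpa using hf'), Category.assoc, Iso.hom_inv_id, Category.comp_id]

attribute [local instance] Abelian.hasFiniteBiproducts

variable {P : Type u₂} [Category.{v} P] [Abelian P]

lemma exists_isJointCokernel {n : ℕ} {A B : P} (r : Fin n → (A ⟶ B)) :
    ∃ (E : P) (π : B ⟶ E), IsJointCokernel r π := by
  refine ⟨_, cokernel.π (biproduct.desc r), fun j => ?_, fun g hg => ?_⟩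
  · rw [← biproduct.ι_desc r j, Category.assoc, cokernel.condition, comp_zero]
  · have hg' : biproduct.desc r ≫ g = 0 := by
      ext j
      simp [hg]
    exact ⟨cokernel.desc _ g hg', cokernel.π_desc _ _ _, fun h hh => by
      rw [← cancel_epi (cokernel.π (biproduct.desc r)), cokernel.π_desc, hh]⟩

lemma exists_isJointKernel {n : ℕ} {A B : P} (r : Fin n → (A ⟶ B)) :
    ∃ (E : P) (ι : E ⟶ A), IsJointKernel r ι := by
  refine ⟨_, kernel.ι (biproduct.lift r), fun j => ?_, fun g hg => ?_⟩
  · rw [← biproduct.lift_π r j, ← Category.assoc, kernel.condition, zero_comp]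
  · have hg' : g ≫ biproduct.lift r = 0 := by
      ext j
      simp [hg]
    exact ⟨kernel.lift _ g hg', kernel.lift_ι _ _ _, fun h hh => by
      rw [← cancel_mono (kernel.ι (biproduct.lift r)), kernel.lift_ι, hh]⟩

/-- A finite joint cokernel is the cokernel of a single morphism out of a direct sum. The target
need only be preadditive, since the image of that morphism is again a sum over the family. -/
lemma IsJointCokernel.map {n : ℕ} {A B E : P} {r : Fin n → (A ⟶ B)} {π : B ⟶ E}
    (h : IsJointCokernel r π) (H : P ⥤ D) [H.Additive] [PreservesFiniteColimits H] :
    IsJointCokernel (fun j => H.map (r j)) (H.map π) := by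
  have hw : biproduct.desc r ≫ π = 0 := by
    ext j
    simp [h.zero]
  have hz {Z : P} (g : B ⟶ Z) (hg : biproduct.desc r ≫ g = 0) (j) : r j ≫ g = 0 := by
    rw [← biproduct.ι_desc r j, Category.assoc, hg, comp_zero]
  have hc : IsColimit (CokernelCofork.ofπ π hw) :=
    CokernelCofork.IsColimit.ofπ π hw (fun g hg => (h.existsUnique g (hz g hg)).choose)
      (fun g hg => (h.existsUnique g (hz g hg)).choose_spec.1)
      (fun g hg m hm => (h.existsUnique g (hz g hg)).choose_spec.2 m hm)
  let hc' := CokernelCofork.mapIsColimit _ hc H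
  refine ⟨fun j => by rw [← H.map_comp, h.zero, H.map_zero], fun {Z} g hg => ?_⟩
  have hg' : H.map (biproduct.desc r) ≫ g = 0 := by
    rw [biproduct.desc_eq, H.map_sum, Preadditive.sum_comp]
    refine Finset.sum_eq_zero fun j _ => ?_
    rw [H.map_comp, Category.assoc, hg, comp_zero]
  obtain ⟨f, hf⟩ : ∃ f : H.obj E ⟶ Z, H.map π ≫ f = g := by
    obtain ⟨f, hf⟩ := CokernelCofork.IsColimit.desc' hc' g hg'
    exact ⟨f, hf⟩
  exact ⟨f, hf, fun f' hf' => Cofork.IsColimit.hom_ext hc' (hf'.trans hf.symm)⟩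

lemma IsJointKernel.map {n : ℕ} {A B E : P} {r : Fin n → (A ⟶ B)} {ι : E ⟶ A}
    (h : IsJointKernel r ι) (H : P ⥤ D) [H.Additive] [PreservesFiniteLimits H] :
    IsJointKernel (fun j => H.map (r j)) (H.map ι) := by
  have hw : ι ≫ biproduct.lift r = 0 := by
    ext j
    simp [h.zero]
  have hz {Z : P} (g : Z ⟶ A) (hg : g ≫ biproduct.lift r = 0) (j) : g ≫ r j = 0 := by
    rw [← biproduct.lift_π r j, ← Category.assoc, hg, zero_comp]
  have hc : IsLimit (KernelFork.ofι ι hw) :=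
    KernelFork.IsLimit.ofι ι hw (fun g hg => (h.existsUnique g (hz g hg)).choose)
      (fun g hg => (h.existsUnique g (hz g hg)).choose_spec.1)
      (fun g hg m hm => (h.existsUnique g (hz g hg)).choose_spec.2 m hm)
  let hc' := KernelFork.mapIsLimit _ hc H
  refine ⟨fun j => by rw [← H.map_comp, h.zero, H.map_zero], fun {Z} g hg => ?_⟩
  have hg' : g ≫ H.map (biproduct.lift r) = 0 := by
    rw [biproduct.lift_eq, H.map_sum, Preadditive.comp_sum]
    refine Finset.sum_eq_zero fun j _ => ?_
    rw [H.map_comp, ← Category.assoc, hg, zero_comp]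
  obtain ⟨f, hf⟩ : ∃ f : Z ⟶ H.obj E, f ≫ H.map ι = g := by
    obtain ⟨f, hf⟩ := KernelFork.IsLimit.lift' hc' g hg'
    exact ⟨f, hf⟩
  exact ⟨f, hf, fun f' hf' => Fork.IsLimit.hom_ext hc' (hf'.trans hf.symm)⟩

end JointCokernels

/-! ### Left exact contravariant functors on a projective generator. -/

section DualKan

variable {C : Type u₁} [Category.{v} C] [Abelian C] {D : Type u₂} [Category.{v} D] [Preadditive D]

lemma eq_zero_of_comp_map_op_eq_zero (H : Cᵒᵖ ⥤ D) [H.Additive] [PreservesFiniteLimits H] {M : C}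
    (hM : IsFiniteGenerator M) {x : C} {e : D} (g : e ⟶ H.obj (op x))
    (hg : ∀ a : M ⟶ x, g ≫ H.map a.op = 0) : g = 0 := by
  have := preservesFiniteColimits_rightOp H
  exact Quiver.Hom.op_inj (eq_zero_of_map_comp_eq_zero H.rightOp hM g.op fun a =>
    congrArg Quiver.Hom.op (hg a))

lemma existsUnique_lift_of_isFiniteGenerator (H : Cᵒᵖ ⥤ D) [H.Additive] [PreservesFiniteLimits H]
    {M : C} [Projective M] (hM : IsFiniteGenerator M) {x : C} {e : D}
    (φ : (M ⟶ x) →+ (e ⟶ H.obj (op M)))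
    (hφ : ∀ (a : M ⟶ M) (b : M ⟶ x), φ (a ≫ b) = φ b ≫ H.map a.op) :
    ∃! ω : e ⟶ H.obj (op x), ∀ a : M ⟶ x, ω ≫ H.map a.op = φ a := by
  have := preservesFiniteColimits_rightOp H
  obtain ⟨ω, hω, hu⟩ := existsUnique_desc_of_isFiniteGenerator H.rightOp hM (x := x) (e := op e)
    { toFun := fun a => (φ a).op
      map_zero' := by rw [map_zero]; rfl
      map_add' := fun a b => by rw [map_add]; rfl }
    (fun a b => congrArg Quiver.Hom.op (hφ a b))
  exact ⟨ω.unop, fun a => Quiver.Hom.op_inj (hω a), fun ω' h' =>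
    Quiver.Hom.op_inj (hu ω'.op fun a => congrArg Quiver.Hom.op (h' a))⟩

end DualKan

/-! ### Coends and ends as finite presentations. -/

section Coends

variable {k : Type v} [Field k] {X : Type u} [Category.{v} X] [Abelian X] [Linear k X]
  [∀ x y : X, Module.Finite k (x ⟶ y)] {P : Type w} [Category.{v} P] [Abelian P] [Linear k P]

/-- The coend of a bifunctor that is right exact in the contravariant variable is computed on a
projective generator of `Xᵒᵖ`. -/
lemma exists_hasCoend_isJointCokernel {I : X} [Injective I] (hI : IsFiniteGenerator (op I))
    (W : Xᵒᵖ ⥤ X ⥤ P) (h₁ : ∀ y, IsRex k (W.flip.obj y)) (h₂ : ∀ a, IsLinearFunctor k (W.obj a)) :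
    ∃ _ : HasCoend W, IsJointCokernel
      (fun j => (W.map (Module.finBasis k (I ⟶ I) j).op).app I -
        (W.obj (op I)).map (Module.finBasis k (I ⟶ I) j)) (coend.ι W I) := by
  have add₁ (y) := (h₁ y).additive
  have lin₁ (y) := (h₁ y).linear
  have rex₁ (y) := (h₁ y).preservesFiniteColimits
  have add₂ (a) := (h₂ a).additive
  have lin₂ (a) := (h₂ a).linear
  obtain ⟨E, π, hE⟩ := exists_isJointCokernel
    (fun j => (W.map (Module.finBasis k (I ⟶ I) j).op).app I -
      (W.obj (op I)).map (Module.finBasis k (I ⟶ I) j))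
  have hπ (f : I ⟶ I) : (W.map f.op).app I ≫ π = (W.obj (op I)).map f ≫ π := by
    -- The defect of dinaturality is linear in `f`, so a basis of End(I) suffices.
    let L : (I ⟶ I) →ₗ[k] ((W.obj (op I)).obj I ⟶ E) :=
      { toFun := fun f => (W.map f.op).app I ≫ π - (W.obj (op I)).map f ≫ π
        map_add' := fun f g => by
          have h : (W.map (f + g).op).app I = (W.map f.op).app I + (W.map g.op).app I :=
            (W.flip.obj I).map_add (f := f.op) (g := g.op)
          rw [h, Functor.map_add, Preadditive.add_comp, Preadditive.add_comp]
          abel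
        map_smul' := fun r f => by
          have h : (W.map (r • f).op).app I = r • (W.map f.op).app I :=
            Functor.map_smul (F := W.flip.obj I) r f.op
          simp [h, Functor.map_smul, smul_sub] }
    have hL : L = 0 := (Module.finBasis k (I ⟶ I)).ext fun j => by
      have := hE.zero j
      rw [Preadditive.sub_comp] at this
      exact this
    exact sub_eq_zero.1 (LinearMap.congr_fun hL f)
  -- The component at `x` is the unique extension of π from `I` that right exactness in the
  -- contravariant variable provides. The covariant variable enters through linearity alone, so the
  -- result covers R ∘ G, which need not be exact on either side.
  have hω (x : X) := existsUnique_desc_of_isFiniteGenerator (W.flip.obj x) hI (x := op x) (e := E)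
    { toFun := fun a => (W.obj (op I)).map a.unop ≫ π
      map_zero' := by simp
      map_add' := fun a b => by simp [Functor.map_add] }
    (fun a b => by
      change (W.obj (op I)).map (b.unop ≫ a.unop) ≫ π =
        (W.map a).app x ≫ (W.obj (op I)).map b.unop ≫ π
      rw [Functor.map_comp, Category.assoc, ← hπ, NatTrans.naturality_assoc]
      rfl)
  choose ω hω hu using hω
  dsimp only at hω hu
  replace hω (x : X) (a : x ⟶ I) : (W.map a.op).app x ≫ ω x = (W.obj (op I)).map a ≫ π :=
    hω x a.op
  have hωI : ω I = π := (hu I π fun a => hπ a.unop).symm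
  let c : Cowedge W := Cowedge.mk E ω fun i j f => by
    rw [← sub_eq_zero]
    refine eq_zero_of_map_comp_eq_zero (W.flip.obj i) hI (x := op j) _ fun a => ?_
    rw [Preadditive.comp_sub, sub_eq_zero]
    change (W.map a).app i ≫ (W.map f.op).app i ≫ ω i =
      (W.map a).app i ≫ (W.obj (op j)).map f ≫ ω j
    have h := hω i (f ≫ a.unop)
    rw [op_comp, Functor.map_comp, NatTrans.comp_app, Category.assoc, Quiver.Hom.op_unop] at h
    rw [h, ← NatTrans.naturality_assoc, Functor.map_comp, Category.assoc, ← hω j]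
    rfl
  have hK {Z : P} (κ : ∀ x : X, (W.obj (op x)).obj x ⟶ Z)
      (hκ : ∀ ⦃x y : X⦄ (f : x ⟶ y), (W.map f.op).app x ≫ κ x = (W.obj (op y)).map f ≫ κ y) :
      ∃ h : E ⟶ Z, (∀ x, ω x ≫ h = κ x) ∧ ∀ h' : E ⟶ Z, π ≫ h' = κ I → h' = h := by
    obtain ⟨h, hh, hu⟩ := hE.existsUnique (κ I) fun j => by
      rw [Preadditive.sub_comp, sub_eq_zero]
      exact hκ _
    refine ⟨h, fun x => ?_, hu⟩
    rw [← sub_eq_zero]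
    refine eq_zero_of_map_comp_eq_zero (W.flip.obj x) hI (x := op x) _ fun a => ?_
    rw [Preadditive.comp_sub, sub_eq_zero]
    change (W.map a.unop.op).app x ≫ ω x ≫ h = (W.map a.unop.op).app x ≫ κ x
    rw [reassoc_of% hω x a.unop, hh]
    exact (hκ a.unop).symm
  choose d hd hdu using fun K : Cowedge W => hK K.π fun _ _ f => Cowedge.condition K f
  let hc : IsColimit c := Multicofork.IsColimit.mk c d hd
    (fun K m hm => hdu K m (by rw [← hωI]; exact hm I))
  have hW : HasCoend W := ⟨⟨⟨c, hc⟩⟩⟩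
  refine ⟨hW, ?_⟩
  -- The chosen coend differs from `E` by a canonical isomorphism, which the presentation absorbs.
  have h : coend.ι W I =
      π ≫ (hc.coconePointUniqueUpToIso (colimit.isColimit (multispanIndexCoend W).multispan)).hom := by
    rw [← hωI]
    exact (hc.comp_coconePointUniqueUpToIso_hom (colimit.isColimit _) (.right I)).symm
  rw [h]
  exact hE.comp_iso _

/-- The end of a bifunctor that is left exact in the contravariant variable is computed on a
projective generator of `X`. -/
lemma exists_hasEnd_isJointKernel {Q : X} [Projective Q] (hQ : IsFiniteGenerator Q)
    (W : Xᵒᵖ ⥤ X ⥤ P) (h₁ : ∀ y, IsLex k (W.flip.obj y)) (h₂ : ∀ a, IsLinearFunctor k (W.obj a)) :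
    ∃ _ : HasEnd W, IsJointKernel
      (fun j => (W.map (Module.finBasis k (Q ⟶ Q) j).op).app Q -
        (W.obj (op Q)).map (Module.finBasis k (Q ⟶ Q) j)) (end_.π W Q) := by
  have add₁ (y) := (h₁ y).additive
  have lin₁ (y) := (h₁ y).linear
  have lex₁ (y) := (h₁ y).preservesFiniteLimits
  have add₂ (a) := (h₂ a).additive
  have lin₂ (a) := (h₂ a).linear
  obtain ⟨E, π, hE⟩ := exists_isJointKernel
    (fun j => (W.map (Module.finBasis k (Q ⟶ Q) j).op).app Q -
      (W.obj (op Q)).map (Module.finBasis k (Q ⟶ Q) j))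
  have hπ (f : Q ⟶ Q) : π ≫ (W.map f.op).app Q = π ≫ (W.obj (op Q)).map f := by
    let L : (Q ⟶ Q) →ₗ[k] (E ⟶ (W.obj (op Q)).obj Q) :=
      { toFun := fun f => π ≫ (W.map f.op).app Q - π ≫ (W.obj (op Q)).map f
        map_add' := fun f g => by
          have h : (W.map (f + g).op).app Q = (W.map f.op).app Q + (W.map g.op).app Q :=
            (W.flip.obj Q).map_add (f := f.op) (g := g.op)
          rw [h, Functor.map_add, Preadditive.comp_add, Preadditive.comp_add]
          abel
        map_smul' := fun r f => by
          have h : (W.map (r • f).op).app Q = r • (W.map f.op).app Q :=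
            Functor.map_smul (F := W.flip.obj Q) r f.op
          simp [h, Functor.map_smul, smul_sub] }
    have hL : L = 0 := (Module.finBasis k (Q ⟶ Q)).ext fun j => by
      have := hE.zero j
      rw [Preadditive.comp_sub] at this
      exact this
    exact sub_eq_zero.1 (LinearMap.congr_fun hL f)
  have hω (x : X) := existsUnique_lift_of_isFiniteGenerator (W.flip.obj x) hQ (x := x) (e := E)
    { toFun := fun a => π ≫ (W.obj (op Q)).map a
      map_zero' := by simp
      map_add' := fun a b => by simp [Functor.map_add] }
    (fun a b => by
      change π ≫ (W.obj (op Q)).map (a ≫ b) = (π ≫ (W.obj (op Q)).map b) ≫ (W.map a.op).app x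
      rw [Functor.map_comp, ← Category.assoc, ← hπ, Category.assoc, Category.assoc,
        NatTrans.naturality])
  choose ω hω hu using hω
  dsimp only at hω hu
  replace hω (x : X) (a : Q ⟶ x) : ω x ≫ (W.map a.op).app x = π ≫ (W.obj (op Q)).map a := hω x a
  have hωQ : ω Q = π := (hu Q π fun a => hπ a).symm
  let c : Wedge W := Wedge.mk E ω fun i j f => by
    rw [← sub_eq_zero]
    refine eq_zero_of_comp_map_op_eq_zero (W.flip.obj j) hQ _ fun a => ?_
    rw [Preadditive.sub_comp, sub_eq_zero]
    change (ω i ≫ (W.obj (op i)).map f) ≫ (W.map a.op).app j =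
      (ω j ≫ (W.map f.op).app j) ≫ (W.map a.op).app j
    have h := hω j (a ≫ f)
    rw [op_comp, Functor.map_comp, NatTrans.comp_app] at h
    rw [Category.assoc, Category.assoc, h, NatTrans.naturality, ← Category.assoc, hω i,
      Functor.map_comp, Category.assoc]
  have hK {Z : P} (κ : ∀ x : X, Z ⟶ (W.obj (op x)).obj x)
      (hκ : ∀ ⦃x y : X⦄ (f : x ⟶ y), κ x ≫ (W.obj (op x)).map f = κ y ≫ (W.map f.op).app y) :
      ∃ h : Z ⟶ E, (∀ x, h ≫ ω x = κ x) ∧ ∀ h' : Z ⟶ E, h' ≫ π = κ Q → h' = h := by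
    obtain ⟨h, hh, hu⟩ := hE.existsUnique (κ Q) fun j => by
      rw [Preadditive.comp_sub, sub_eq_zero]
      exact (hκ _).symm
    refine ⟨h, fun x => ?_, hu⟩
    rw [← sub_eq_zero]
    refine eq_zero_of_comp_map_op_eq_zero (W.flip.obj x) hQ _ fun a => ?_
    rw [Preadditive.sub_comp, sub_eq_zero, Category.assoc]
    change h ≫ ω x ≫ (W.map a.op).app x = κ x ≫ (W.map a.op).app x
    rw [hω x a, ← Category.assoc, hh]
    exact hκ a
  choose d hd hdu using fun K : Wedge W => hK K.ι fun _ _ f => Wedge.condition K f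
  let hc : IsLimit c := Multifork.IsLimit.mk c d hd
    (fun K m hm => hdu K m (by rw [← hωQ]; exact hm Q))
  have hW : HasEnd W := ⟨⟨⟨c, hc⟩⟩⟩
  refine ⟨hW, ?_⟩
  have h : end_.π W Q =
      ((limit.isLimit (multicospanIndexEnd W).multicospan).conePointUniqueUpToIso hc).hom ≫ π := by
    rw [← hωQ]
    exact ((limit.isLimit _).conePointUniqueUpToIso_hom_comp hc (.left Q)).symm
  rw [h]
  exact hE.iso_comp _

end Coends

noncomputable section

/-! ### Linear functors commute with the action of vector spaces. -/

section Copowers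

attribute [local instance] Abelian.hasFiniteBiproducts

variable (k : Type v) [Field k] {C : Type u} [Category.{v} C] [Abelian C] [Linear k C]

/-- Additive functors commute with finite direct sums. -/
@[simps]
def mapPowerIso (R : C ⥤ C) [R.Additive] (n : ℕ) (c : C) :
    R.obj (⨁ fun _ : Fin n => c) ≅ ⨁ fun _ : Fin n => R.obj c where
  hom := biproduct.lift fun j => R.map (biproduct.π (fun _ : Fin n => c) j)
  inv := biproduct.desc fun j => R.map (biproduct.ι (fun _ : Fin n => c) j)
  hom_inv_id := by
    rw [biproduct.lift_desc]
    simp only [← R.map_comp]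
    rw [← R.map_sum, biproduct.total, R.map_id]
  inv_hom_id := by
    ext i j
    simp only [Category.assoc, biproduct.lift_π, biproduct.ι_desc_assoc, ← R.map_comp,
      Category.id_comp]
    by_cases h : j = i
    · subst h
      simp
    · rw [biproduct.ι_π_ne _ h, biproduct.ι_π_ne _ h, R.map_zero]

/-- A linear functor preserves matrices of scalars; this is the naturality of `copowerCompIso` in
the vector space. -/
lemma map_matrix_mapPowerIso_hom (R : C ⥤ C) [R.Additive] [R.Linear k] {m n : ℕ}
    (A : Fin m → Fin n → k) (c : C) :
    R.map (biproduct.matrix (f := fun _ => c) (g := fun _ => c) fun i j => A i j • 𝟙 c) ≫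
        (mapPowerIso R n c).hom =
      (mapPowerIso R m c).hom ≫
        biproduct.matrix (f := fun _ => R.obj c) (g := fun _ => R.obj c)
          fun i j => A i j • 𝟙 (R.obj c) := by
  refine biproduct.hom_ext _ _ fun j => ?_
  rw [Category.assoc, Category.assoc, biproduct.matrix_π, mapPowerIso_hom, mapPowerIso_hom,
    biproduct.lift_π, ← R.map_comp, biproduct.matrix_π, biproduct.desc_eq, biproduct.lift_desc,
    R.map_sum]
  refine Finset.sum_congr rfl fun i _ => ?_
  simp [Functor.map_smul]

/-- Linear functors commute with the action of finite-dimensional vector spaces. -/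
def copowerCompIso (R : C ⥤ C) [R.Additive] [R.Linear k] :
    copower k C ⋙ (Functor.whiskeringRight C C C).obj R ≅
      copower k C ⋙ (Functor.whiskeringLeft C C C).obj R :=
  NatIso.ofComponents
    (fun V => NatIso.ofComponents
      (fun c => mapPowerIso R (Module.finrank k V) c)
      (fun {c d} g => by
        refine biproduct.hom_ext _ _ fun j => ?_
        simp [copower, ← Functor.map_comp]))
    (fun {V W} f => by
      ext c
      exact map_matrix_mapPowerIso_hom k R _ c)

variable {X : Type u₁} [Category.{v} X]

/-- Linear functors commute with the bifunctors `(a, b) ↦ h(a, -) ⊗ b`. -/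
def kernelCompIso (h : Xᵒᵖ ⥤ X ⥤ FGModuleCat.{v} k) (R : C ⥤ C) [R.Additive] [R.Linear k] :
    (h ⋙ (Functor.whiskeringRight X (FGModuleCat.{v} k) (C ⥤ C)).obj (copower k C) ⋙
        flipFunctor X C C) ⋙
      (Functor.whiskeringRight C (X ⥤ C) (X ⥤ C)).obj ((Functor.whiskeringRight X C C).obj R) ≅
    (h ⋙ (Functor.whiskeringRight X (FGModuleCat.{v} k) (C ⥤ C)).obj (copower k C) ⋙
        flipFunctor X C C) ⋙ (Functor.whiskeringLeft C C (X ⥤ C)).obj R :=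
  NatIso.ofComponents
    (fun a => NatIso.ofComponents
      (fun b => NatIso.ofComponents
        (fun y => ((copowerCompIso k R).app ((h.obj a).obj y)).app b)
        (fun {y y'} g => congrArg (fun α => α.app b)
          ((copowerCompIso k R).hom.naturality ((h.obj a).map g))))
      (fun {b b'} g => by
        ext y
        exact ((copowerCompIso k R).hom.app ((h.obj a).obj y)).naturality g))
    (fun {a a'} f => by
      ext b y
      exact congrArg (fun α => α.app b)
        ((copowerCompIso k R).hom.naturality ((h.map f).app y)))

end Copowers

/-! ### Moving a linear functor inside Φ. -/

section Composition

variable {k : Type v} [Field k] {X : Type u} [Category.{v} X] [Abelian X] [Linear k X]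
  {P : Type w} [Category.{v} P] [Abelian P] {T : Xᵒᵖ ⥤ X ⥤ P} {Φ : P ⥤ X ⥤ X}

instance whiskeringRight_obj_additive (R : X ⥤ X) [R.Additive] :
    ((Functor.whiskeringRight X X X).obj R).Additive where
  map_add {F G α β} := by
    ext y
    exact R.map_add

/-- If `Φ(T(a, b)) ≅ h(a, -) ⊗ b`, then `R ∘ Φ(T(a, b)) ≅ Φ(T(a, R b))`. -/
def boxCompIso (h : Xᵒᵖ ⥤ X ⥤ FGModuleCat.{v} k)
    (e : restrict T Φ ≅ h ⋙ (Functor.whiskeringRight X (FGModuleCat.{v} k) (X ⥤ X)).obj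
      (copower k X) ⋙ flipFunctor X X X) (R : X ⥤ X) [R.Additive] [R.Linear k] :
    restrict T Φ ⋙ (Functor.whiskeringRight X (X ⥤ X) (X ⥤ X)).obj
        ((Functor.whiskeringRight X X X).obj R) ≅
      restrict T Φ ⋙ (Functor.whiskeringLeft X X (X ⥤ X)).obj R :=
  Functor.isoWhiskerRight e _ ≪≫ kernelCompIso k h R ≪≫ Functor.isoWhiskerRight e.symm _

/-- Each relation is a difference of an action in the first variable and one in the second, and θ is
natural in both. Source and target of a relation are the same object, so one `e` serves at both
ends. Taking θ as a hypothesis lets Φˡ and Φʳ share the argument. -/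
lemma boxCompIso_relation
    (θ : ∀ R : X ⥤ X, IsLinearFunctor k R → Nonempty
      (restrict T Φ ⋙ (Functor.whiskeringRight X (X ⥤ X) (X ⥤ X)).obj
        ((Functor.whiskeringRight X X X).obj R) ≅
      restrict T Φ ⋙ (Functor.whiskeringLeft X X (X ⥤ X)).obj R))
    [Φ.Additive] (G R : X ⥤ X) (hR : IsLinearFunctor k R) (I : X) :
    ∃ e : Φ.obj ((T.obj (op I)).obj (G.obj I)) ⋙ R ≅ Φ.obj ((T.obj (op I)).obj (R.obj (G.obj I))),
      ∀ f : I ⟶ I, Functor.whiskerRight (Φ.map (((boxFunctor T G).map f.op).app I -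
          ((boxFunctor T G).obj (op I)).map f)) R ≫ e.hom =
        e.hom ≫ Φ.map (((boxFunctor T (G ⋙ R)).map f.op).app I -
          ((boxFunctor T (G ⋙ R)).obj (op I)).map f) := by
  obtain ⟨θ⟩ := θ R hR
  have := hR.additive
  refine ⟨(θ.app (op I)).app (G.obj I), fun f => ?_⟩
  have h₁ := congrArg (fun α => α.app (G.obj I)) (θ.hom.naturality f.op)
  have h₂ := (θ.hom.app (op I)).naturality (G.map f)
  have h₃ : Functor.whiskerRight (Φ.map ((T.map f.op).app (G.obj I) -
        (T.obj (op I)).map (G.map f))) R =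
      Functor.whiskerRight (Φ.map ((T.map f.op).app (G.obj I))) R -
        Functor.whiskerRight (Φ.map ((T.obj (op I)).map (G.map f))) R := by
    rw [Φ.map_sub]
    exact ((Functor.whiskeringRight X X X).obj R).map_sub
  change Functor.whiskerRight (Φ.map ((T.map f.op).app (G.obj I) -
        (T.obj (op I)).map (G.map f))) R ≫ (θ.hom.app (op I)).app (G.obj I) =
    (θ.hom.app (op I)).app (G.obj I) ≫ Φ.map ((T.map f.op).app (R.obj (G.obj I)) -
        (T.obj (op I)).map (R.map (G.map f)))
  rw [h₃, Φ.map_sub, Preadditive.sub_comp, Preadditive.comp_sub]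
  exact congrArg₂ (· - ·) h₁ h₂

end Composition

end

/-! ### Left exactness of ⊠ and the two composition formulas. -/

section Main

variable {k : Type v} [Field k] {X : Type u} [Category.{v} X] [Abelian X] [Linear k X]
  {P : Type w} [Category.{v} P] [Abelian P] [Linear k P] {T : Xᵒᵖ ⥤ X ⥤ P}

lemma IsLinearFunctor.comp {F G : X ⥤ X} (hF : IsLinearFunctor k F) (hG : IsLinearFunctor k G) :
    IsLinearFunctor k (F ⋙ G) := by
  have := hF.additive
  have := hF.linear
  have := hG.additive
  have := hG.linear
  exact ⟨inferInstance, inferInstance⟩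

lemma isLinearFunctor_boxFunctor_obj (hT : IsBiRex k T) {F : X ⥤ X} (hF : IsLinearFunctor k F)
    (a : Xᵒᵖ) : IsLinearFunctor k ((boxFunctor T F).obj a) := by
  have := hF.additive
  have := hF.linear
  have := (hT.right a).additive
  have := (hT.right a).linear
  exact ⟨inferInstanceAs (F ⋙ T.obj a).Additive, inferInstanceAs ((F ⋙ T.obj a).Linear k)⟩

instance finite_hom_opposite (C : Type u) [Category.{v} C] [Preadditive C] [Linear k C]
    [∀ x y : C, Module.Finite k (x ⟶ y)] (x y : Cᵒᵖ) : Module.Finite k (x ⟶ y) :=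
  Module.Finite.equiv (M := (y.unop ⟶ x.unop))
    { toFun := Quiver.Hom.op
      invFun := Quiver.Hom.unop
      map_add' := fun _ _ => rfl
      map_smul' := fun _ _ => rfl
      left_inv := fun _ => rfl
      right_inv := fun _ => rfl }

lemma exists_generators (k : Type v) [Field k] (X : Type u) [Category.{v} X] [Abelian X]
    [Linear k X] [FiniteLinearCategory k X] : ∃ Q I : X, Projective Q ∧ IsFiniteGenerator Q ∧ Injective I ∧
    IsFiniteGenerator (op I) := by
  obtain ⟨Q, hQ, hQ'⟩ := exists_projective_isSeparator k X
  obtain ⟨I, hI, hI'⟩ := exists_injective_isCoseparator k hQ'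
  exact ⟨Q, I, hQ, isFiniteGenerator_of_isSeparator k hQ', hI,
    isFiniteGenerator_of_isSeparator k ((isSeparator_op_iff I).2 hI')⟩

variable [FiniteLinearCategory k X] [FiniteLinearCategory k P]

/-- A Deligne product `Xᵒᵖ × X ⥤ P` is left exact in the first variable. -/
lemma IsDeligneProduct.isLex_flip_obj (hT : IsDeligneProduct k T) (x : X) :
    IsLex k (T.flip.obj x) := by
  obtain ⟨Q, I, hQ, hQ', hI, hI'⟩ := exists_generators k X
  obtain ⟨hlin, hrex⟩ := hT.biRex.left x
  have := hlin.additive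
  -- The generators used are `op I` for `Xᵒᵖ` and `Q` for `X`.
  have : (T.flip.obj x).PreservesMonomorphisms := ⟨fun f _ => hT.mono_map_app hI' hQ' f x⟩
  have := Functor.preservesHomology_of_preservesMonos_and_cokernels (T.flip.obj x)
  exact ⟨hlin, Functor.preservesFiniteLimits_of_preservesHomology _⟩

lemma exists_gammaRL_comp_iso (hT : IsDeligneProduct k T) {Φ : P ⥤ X ⥤ X} (hΦ : IsPhiR k T Φ)
    (F G : X ⥤ X) (hF : IsLinearFunctor k F) (hG : IsLinearFunctor k G) :
    ∃ (_ : HasCoend (boxFunctor T F)) (_ : HasCoend (boxFunctor T G))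
      (_ : HasCoend (boxFunctor T (G ⋙ gammaRL T Φ F))),
      Nonempty (gammaRL T Φ G ⋙ gammaRL T Φ F ≅ gammaRL T Φ (G ⋙ gammaRL T Φ F)) := by
  obtain ⟨-, I, -, -, hI, hI'⟩ := exists_generators k X
  have key (H : X ⥤ X) (hH : IsLinearFunctor k H) := exists_hasCoend_isJointCokernel (k := k) hI'
    (boxFunctor T H) (fun y => hT.biRex.left (H.obj y)) (isLinearFunctor_boxFunctor_obj hT.biRex hH)
  obtain ⟨cF, -⟩ := key F hF
  obtain ⟨cG, hcG⟩ := key G hG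
  let R := gammaRL T Φ F
  have hR : IsRex k R := hΦ.isRex_obj _
  obtain ⟨cR, hcR⟩ := key (G ⋙ R) (hG.comp hR.toIsLinearFunctor)
  refine ⟨cF, cG, cR, ?_⟩
  have := hΦ.isRex.additive
  have := hΦ.isRex.preservesFiniteColimits
  have := hR.additive
  have := hR.preservesFiniteColimits
  -- Colimits of functors are pointwise, so postcomposition with a right exact functor is right
  -- exact.
  have : PreservesFiniteColimits ((Functor.whiskeringRight X X X).obj R) :=
    ⟨fun _ _ _ => inferInstance⟩
  obtain ⟨e, he⟩ := boxCompIso_relation (k := k) (T := T) (Φ := Φ) (fun R hR => by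
    have := hR.additive
    have := hR.linear
    exact hΦ.on_boxes.map fun e => boxCompIso _ e R) G R hR.toIsLinearFunctor I
  -- The image of the presentation for `G` under R ∘ Φ(-) is compared with the image of the
  -- presentation for R ∘ G under Φ.
  exact (hcG.map (Φ ⋙ (Functor.whiskeringRight X X X).obj R)).nonempty_iso (hcR.map Φ) e e
    fun j => he _

lemma exists_gammaLR_comp_iso (hT : IsDeligneProduct k T) {Φ : P ⥤ X ⥤ X} (hΦ : IsPhiL k T Φ)
    (F G : X ⥤ X) (hF : IsLinearFunctor k F) (hG : IsLinearFunctor k G) :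
    ∃ (_ : HasEnd (boxFunctor T F)) (_ : HasEnd (boxFunctor T G))
      (_ : HasEnd (boxFunctor T (G ⋙ gammaLR T Φ F))),
      Nonempty (gammaLR T Φ G ⋙ gammaLR T Φ F ≅ gammaLR T Φ (G ⋙ gammaLR T Φ F)) := by
  obtain ⟨Q, -, hQ, hQ', -, -⟩ := exists_generators k X
  have key (H : X ⥤ X) (hH : IsLinearFunctor k H) := exists_hasEnd_isJointKernel (k := k) hQ'
    (boxFunctor T H) (fun y => hT.isLex_flip_obj (H.obj y))
    (isLinearFunctor_boxFunctor_obj hT.biRex hH)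
  obtain ⟨cF, -⟩ := key F hF
  obtain ⟨cG, hcG⟩ := key G hG
  let R := gammaLR T Φ F
  have hR : IsLex k R := hΦ.isLex_obj _
  obtain ⟨cR, hcR⟩ := key (G ⋙ R) (hG.comp hR.toIsLinearFunctor)
  refine ⟨cF, cG, cR, ?_⟩
  have := hΦ.isLex.additive
  have := hΦ.isLex.preservesFiniteLimits
  have := hR.additive
  have := hR.preservesFiniteLimits
  have : PreservesFiniteLimits ((Functor.whiskeringRight X X X).obj R) :=
    ⟨fun _ _ _ => inferInstance⟩
  obtain ⟨e, he⟩ := boxCompIso_relation (k := k) (T := T) (Φ := Φ) (fun R hR => by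
    have := hR.additive
    have := hR.linear
    exact hΦ.on_boxes.map fun e => boxCompIso _ e R) G R hR.toIsLinearFunctor Q
  exact (hcG.map (Φ ⋙ (Functor.whiskeringRight X X X).obj R)).nonempty_iso (hcR.map Φ) e e
    fun j => he _

end Main

end EilenbergWatts

theorem mainTheorem6 (k : Type v) [Field k] [IsAlgClosed k]
    (X : Type u) [Category.{v} X] [Abelian X] [Linear k X]
    [FiniteLinearCategory k X]
    (P : Type w) [Category.{v} P] [Abelian P] [Linear k P]
    [FiniteLinearCategory k P]
    (T : Xᵒᵖ ⥤ X ⥤ P) (hT : IsDeligneProduct k T)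
    (Φl Φr : P ⥤ X ⥤ X) (hl : IsPhiL k T Φl) (hr : IsPhiR k T Φr) :
    (∀ F G : X ⥤ X, IsLex k F → IsLex k G →
      ∃ (_ : HasCoend (boxFunctor T F))
        (_ : HasCoend (boxFunctor T G))
        (_ : HasCoend (boxFunctor T (G ⋙ gammaRL T Φr F))),
        Nonempty (gammaRL T Φr G ⋙ gammaRL T Φr F ≅
          gammaRL T Φr (G ⋙ gammaRL T Φr F))) ∧
    (∀ F G : X ⥤ X, IsRex k F → IsRex k G →
      ∃ (_ : HasEnd (boxFunctor T F))
        (_ : HasEnd (boxFunctor T G))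
        (_ : HasEnd (boxFunctor T (G ⋙ gammaLR T Φl F))),
        Nonempty (gammaLR T Φl G ⋙ gammaLR T Φl F ≅
          gammaLR T Φl (G ⋙ gammaLR T Φl F))) := by
  exact ⟨fun F G hF hG => exists_gammaRL_comp_iso hT hr F G hF.toIsLinearFunctor
      hG.toIsLinearFunctor,
    fun F G hF hG => exists_gammaLR_comp_iso hT hl F G hF.toIsLinearFunctor hG.toIsLinearFunctor⟩
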